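/- Let $k$ be an artinian local ring and $V$ a free $k$-module (not necessarily of finite rank). **Commensurability.** Free submodules $A,B\subset V$ are *commensurable*, $A\sim B$, if $(A+B)/(A\cap B)$ is finitely generated over $k$. For a free submodule $V_+\subset V$ let $G^V_{V_+}$ be the group of $k$-linear automorphisms $\sigma$ of $V$ with $V_+\sim\sigma V_+$. **Determinant groupoid.** For a free $k$-module $M$ of finite rank let $\det M$ be its maximal exterior power. For commensurable free $A,B\subset V$ let $\mathcal P(A,B)$ be the set of free submodules $P\subset A\cap B$ such that $A/P$ and $B/P$ are free of finite rank, and for $P\in\mathcal P(A,B)$ let $\mathrm{Det}(A,B;P)$ be the set of $k$-linear isomorphisms $\det(A/P)\to\det(B/P)$. For $Q\subset P$ in $\mathcal P(A,B)$ there is a canonical bijection (cancellation rule) $\mathrm{Det}(A,B;Q)\to\mathrm{Det}(A,B;P)$, under which $\alpha_Q\mapsto\alpha_P$ if and only if $\alpha_Q(p\wedge\tilde a)=p\wedge\tilde b$ whenever $\alpha_P(a)=b$, where $p\in\det(P/Q)$ and $\tilde a,\tilde b$ are liftings of $a\in\det(A/P)$, $b\in\det(B/P)$ to exterior powers of $A/Q$,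 $B/Q$. Put $\mathrm{Det}(A,B)=\varprojlim_{P}\mathrm{Det}(A,B;P)$, a $k^\times$-torsor. With the evident composition, the free submodules commensurable to $V_+$ together with the sets $\mathrm{Det}(A,B)$ form a connected groupoid $\mathrm{Det}^V_{V_+}$, on which every $\sigma\in G^V_{V_+}$ acts by a functor $\sigma_*$. **Symbol.** Let $\tilde G^V_{V_+}$ be the group of pairs $(\sigma,\Phi)$ with $\sigma\in G^V_{V_+}$ and $\Phi$ a natural transformation from the identity functor of $\mathrm{Det}^V_{V_+}$ to $\sigma_*$, with the product $$(\sigma_1,\Phi_1)(\sigma_2,\Phi_2)=\bigl(\sigma_1\sigma_2,\ A\mapsto \sigma_{1*}(\Phi_2(A))\circ\Phi_1(A)\bigr).$$ It is a central extension of $G^V_{V_+}$ by $k^\times$, where $x\in k^\times$ is identified with $(1,A\mapsto x\cdot 1_A)$. For commuting $\sigma,\tau\in G^V_{V_+}$ put $$\{\sigma,\tau\}^V_{V_+}=\tilde\sigma\tilde\tau\tilde\sigma^{-1}\tilde\tau^{-1}\in k^\times$$ for any liftings $\tilde\sigma,\tilde\tau\in\tilde G^V_{V_+}$ of $\sigma,\tau$.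 **Proposition.** Let $V_+,V_-\subset V$ be free $k$-submodules with $V=V_+\oplus V_-$, and let $\sigma,\tau\in G^V_{V_+}\cap G^V_{V_-}$ be commuting elements. Then the symbols $\{\sigma,\tau\}^V_{V_+}$ and $\{\sigma,\tau\}^V_{V_-}$ are well defined (liftings exist, and the commutator does not depend on their choice), and $$\{\sigma,\tau\}^V_{V_+}\,\{\sigma,\tau\}^V_{V_-}=1.$$ -/

import Mathlib

noncomputable section

namespace DetGroupoid

variable {k : Type*} [CommRing k]

/-- `det M`: the maximal exterior power of a free module `M` of finite rank. -/
abbrev DetLine (k : Type*) [CommRing k] (M : Type*) [AddCommGroup M] [Module k M] : Type _ :=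
  ↥(⋀[k]^(Module.finrank k M) M)

theorem map_mem_exteriorPower {M N : Type*} [AddCommGroup M] [Module k M]
    [AddCommGroup N] [Module k N] (f : M →ₗ[k] N) {n : ℕ} {x : ExteriorAlgebra k M}
    (hx : x ∈ ⋀[k]^n M) : ExteriorAlgebra.map f x ∈ ⋀[k]^n N := by
  have h : (⋀[k]^n M).map (ExteriorAlgebra.map f).toLinearMap ≤ ⋀[k]^n N := by
    rw [Submodule.map_pow]
    refine pow_le_pow_left' ?_ n
    rintro _ ⟨_, ⟨m, rfl⟩, rfl⟩
    exact ⟨f m, (ExteriorAlgebra.map_apply_ι f m).symm⟩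
  exact h ⟨x, hx, rfl⟩

theorem map_map {M N L : Type*} [AddCommGroup M] [Module k M] [AddCommGroup N] [Module k N]
    [AddCommGroup L] [Module k L] (f : M →ₗ[k] N) (g : N →ₗ[k] L) (x : ExteriorAlgebra k M) :
    ExteriorAlgebra.map g (ExteriorAlgebra.map f x) = ExteriorAlgebra.map (g ∘ₗ f) x := by
  rw [← ExteriorAlgebra.map_comp_map]; rfl

theorem map_symm_map {M N : Type*} [AddCommGroup M] [Module k M] [AddCommGroup N] [Module k N]
    (e : M ≃ₗ[k] N) (x : ExteriorAlgebra k M) :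
    ExteriorAlgebra.map (e.symm : N →ₗ[k] M) (ExteriorAlgebra.map (e : M →ₗ[k] N) x) = x := by
  rw [map_map]
  simp

/-- The isomorphism `det M ≃ det N` induced by an isomorphism `e : M ≃ N`. -/
def detEquiv {M N : Type*} [AddCommGroup M] [Module k M] [AddCommGroup N] [Module k N]
    (e : M ≃ₗ[k] N) : DetLine k M ≃ₗ[k] DetLine k N where
  toFun x := ⟨ExteriorAlgebra.map (e : M →ₗ[k] N) x,
    e.finrank_eq ▸ map_mem_exteriorPower (e : M →ₗ[k] N) x.2⟩
  invFun y := ⟨ExteriorAlgebra.map (e.symm : N →ₗ[k] M) y,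
    e.finrank_eq.symm ▸ map_mem_exteriorPower (e.symm : N →ₗ[k] M) y.2⟩
  map_add' x y := Subtype.ext (by simp)
  map_smul' c x := Subtype.ext (by simp)
  left_inv x := Subtype.ext (map_symm_map e x)
  right_inv y := Subtype.ext (map_symm_map e.symm y)

variable {V : Type*} [AddCommGroup V] [Module k V]

/-- The quotient `A / P` for submodules `P ≤ A` of `V`. -/
abbrev SubQuot (A P : Submodule k V) : Type _ := ↥A ⧸ P.submoduleOf A

/-- `A ∼ B`: the quotient `(A + B) / (A ∩ B)` is finitely generated. -/
def Commensurable (A B : Submodule k V) : Prop := Module.Finite k (SubQuot (A ⊔ B) (A ⊓ B))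

/-- `P` is a free submodule of `A` such that `A / P` is free of finite rank. -/
structure Admissible (A P : Submodule k V) : Prop where
  le : P ≤ A
  free : Module.Free k P
  free_quot : Module.Free k (SubQuot A P)
  finite_quot : Module.Finite k (SubQuot A P)

/-- For `A ≤ B` and `P ≤ Q`, the natural map `A / P → B / Q`. -/
def subQuotMap {A B P Q : Submodule k V} (hAB : A ≤ B) (hPQ : P ≤ Q) :
    SubQuot A P →ₗ[k] SubQuot B Q :=
  Submodule.mapQ _ _ (Submodule.inclusion hAB) (fun _ hx => hPQ hx)

/-- An automorphism `σ` of `V` with `σ A = A'` induces `A / σ⁻¹ P ≃ A' / P`. -/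
def subQuotEquiv (σ : V ≃ₗ[k] V) {A A' : Submodule k V}
    (hA : A.map (σ : V →ₗ[k] V) = A') (P : Submodule k V) :
    SubQuot A (P.comap (σ : V →ₗ[k] V)) ≃ₗ[k] SubQuot A' P :=
  Submodule.Quotient.equiv _ _ (σ.ofSubmodules A A' hA) (by
    ext ⟨y, hy⟩
    constructor
    · rintro ⟨x, hx, hxy⟩
      rw [← hxy]
      exact hx
    · intro h
      refine ⟨(σ.ofSubmodules A A' hA).symm ⟨y, hy⟩, ?_, by simp⟩
      simpa [Submodule.submoduleOf] using h)

theorem Admissible.comap (σ : V ≃ₗ[k] V) {A A' : Submodule k V}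
    (hA : A.map (σ : V →ₗ[k] V) = A') {P : Submodule k V} (h : Admissible A' P) :
    Admissible A (P.comap (σ : V →ₗ[k] V)) where
  le := by
    intro x hx
    have := h.le hx
    rw [← hA] at this
    obtain ⟨y, hy, hyx⟩ := this
    exact σ.injective hyx ▸ hy
  free := by
    have := h.free
    exact Module.Free.of_equiv (σ.ofSubmodules (P.comap (σ : V →ₗ[k] V)) P
      (Submodule.map_comap_eq_of_surjective σ.surjective P)).symm
  free_quot := by
    have := h.free_quot
    exact Module.Free.of_equiv (subQuotEquiv σ hA P).symm
  finite_quot := by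
    have := h.finite_quot
    exact Module.Finite.equiv (subQuotEquiv σ hA P).symm

theorem map_subQuotMap_symm (σ : V ≃ₗ[k] V) {A A' B B' P Q : Submodule k V}
    (hA : A.map (σ : V →ₗ[k] V) = A') (hB : B.map (σ : V →ₗ[k] V) = B')
    (hAB : A ≤ B) (hAB' : A' ≤ B') (hPQ : P ≤ Q) (x : ExteriorAlgebra k (SubQuot A' P)) :
    ExteriorAlgebra.map (subQuotEquiv σ hB Q).symm.toLinearMap
      (ExteriorAlgebra.map (subQuotMap hAB' hPQ) x) =
    ExteriorAlgebra.map (subQuotMap hAB (Submodule.comap_mono hPQ))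
      (ExteriorAlgebra.map (subQuotEquiv σ hA P).symm.toLinearMap x) := by
  rw [map_map, map_map]
  congr 2
  refine LinearMap.ext fun y => ?_
  obtain ⟨z, rfl⟩ := (subQuotEquiv σ hA P).surjective y
  simp only [LinearMap.comp_apply, LinearEquiv.coe_coe, LinearEquiv.symm_apply_apply]
  rw [LinearEquiv.symm_apply_eq]
  obtain ⟨w, rfl⟩ := Submodule.Quotient.mk_surjective _ z
  rfl

/-- The cancellation rule, as a relation. For `Q ≤ P ≤ A ⊓ B`, it matches
`αQ : det (A/Q) ≃ det (B/Q)` with `αP : det (A/P) ≃ det (B/P)` when `αP a' = b'` implies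
`αQ (p ∧ a) = p ∧ b`, for all `p` in `det (P/Q)` and all liftings `a`, `b` to exterior powers of
`A/Q`, `B/Q` of elements `a'`, `b'` of `det (A/P)`, `det (B/P)`. -/
def Cancels {A B P Q : Submodule k V} (hQP : Q ≤ P) (hPA : P ≤ A) (hPB : P ≤ B)
    (αQ : DetLine k (SubQuot A Q) ≃ₗ[k] DetLine k (SubQuot B Q))
    (αP : DetLine k (SubQuot A P) ≃ₗ[k] DetLine k (SubQuot B P)) : Prop :=
  ∀ (p : DetLine k (SubQuot P Q))
    (a : ⋀[k]^(Module.finrank k (SubQuot A P)) (SubQuot A Q))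
    (b : ⋀[k]^(Module.finrank k (SubQuot B P)) (SubQuot B Q))
    (a' : DetLine k (SubQuot A P)) (b' : DetLine k (SubQuot B P))
    (pa : DetLine k (SubQuot A Q)) (pb : DetLine k (SubQuot B Q)),
    (a' : ExteriorAlgebra k (SubQuot A P)) = ExteriorAlgebra.map (subQuotMap le_rfl hQP) a →
    (b' : ExteriorAlgebra k (SubQuot B P)) = ExteriorAlgebra.map (subQuotMap le_rfl hQP) b →
    (pa : ExteriorAlgebra k (SubQuot A Q)) = ExteriorAlgebra.map (subQuotMap hPA (le_refl Q)) p *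
      (a : ExteriorAlgebra k (SubQuot A Q)) →
    (pb : ExteriorAlgebra k (SubQuot B Q)) = ExteriorAlgebra.map (subQuotMap hPB (le_refl Q)) p *
      (b : ExteriorAlgebra k (SubQuot B Q)) →
    αP a' = b' → αQ pa = pb

/-- `Det(A, B)`: the inverse limit, over all free `P ≤ A ⊓ B` with `A / P` and `B / P` free of
finite rank, of the sets of isomorphisms `det (A/P) ≃ det (B/P)`, the transition maps being given
by the cancellation rule. -/
@[ext]
structure DetHom (A B : Submodule k V) where
  app : ∀ P : Submodule k V, Admissible A P → Admissible B P →
    (DetLine k (SubQuot A P) ≃ₗ[k] DetLine k (SubQuot B P))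
  cancels : ∀ (P Q : Submodule k V) (hAP : Admissible A P) (hBP : Admissible B P)
    (hAQ : Admissible A Q) (hBQ : Admissible B Q) (hQP : Q ≤ P),
    Cancels hQP hAP.le hBP.le (app Q hAQ hBQ) (app P hAP hBP)

/-- Scalar multiplication of `kˣ` on `Det(A, B)`. -/
def DetHom.smul {A B : Submodule k V} (c : kˣ) (α : DetHom A B) : DetHom A B where
  app P hA hB := (α.app P hA hB).trans (LinearEquiv.smulOfUnit c)
  cancels P Q hAP hBP hAQ hBQ hQP := by
    intro p a b a' b' pa pb ha hb hpa hpb h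
    have h1 : (α.app P hAP hBP) a' = (c⁻¹ : kˣ) • b' := by
      rw [← h]
      change _ = (c⁻¹ : kˣ) • (c • (α.app P hAP hBP) a')
      rw [inv_smul_smul]
    have h2 := α.cancels P Q hAP hBP hAQ hBQ hQP p a ((c⁻¹ : kˣ) • b) a' ((c⁻¹ : kˣ) • b') pa
      ((c⁻¹ : kˣ) • pb) ha (by simp [Units.smul_def, hb]) hpa (by simp [Units.smul_def, hpb]) h1
    change c • (α.app Q hAQ hBQ) pa = pb
    rw [h2, smul_inv_smul]

/-- `γ = β ∘ α` in the inverse limit. -/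
def IsComp {A B C : Submodule k V} (α : DetHom A B) (β : DetHom B C) (γ : DetHom A C) : Prop :=
  ∀ (P : Submodule k V) (hA : Admissible A P) (hB : Admissible B P) (hC : Admissible C P)
    (x : DetLine k (SubQuot A P)),
    γ.app P hA hC x = β.app P hB hC (α.app P hA hB x)

/-- `σ_* α` in `Det(σ A, σ B)`, for `α` in `Det(A, B)`. -/
def DetHom.push (σ : V ≃ₗ[k] V) {A B A' B' : Submodule k V}
    (hA : A.map (σ : V →ₗ[k] V) = A') (hB : B.map (σ : V →ₗ[k] V) = B')
    (α : DetHom A B) : DetHom A' B' where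
  app P hAP hBP :=
    (detEquiv (subQuotEquiv σ hA P)).symm.trans
      ((α.app (P.comap (σ : V →ₗ[k] V)) (hAP.comap σ hA) (hBP.comap σ hB)).trans
        (detEquiv (subQuotEquiv σ hB P)))
  cancels P Q hAP hBP hAQ hBQ hQP := by
    intro p a b a' b' pa pb ha hb hpa hpb h
    have hP := Submodule.map_comap_eq_of_surjective σ.surjective P
    have hQP' := Submodule.comap_mono (f := (σ : V →ₗ[k] V)) hQP
    have key := α.cancels _ _ (hAP.comap σ hA) (hBP.comap σ hB) (hAQ.comap σ hA)
      (hBQ.comap σ hB) hQP' ((detEquiv (subQuotEquiv σ hP Q)).symm p)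
      ⟨ExteriorAlgebra.map (subQuotEquiv σ hA Q).symm.toLinearMap a,
        (subQuotEquiv σ hA P).finrank_eq.symm ▸ map_mem_exteriorPower _ a.2⟩
      ⟨ExteriorAlgebra.map (subQuotEquiv σ hB Q).symm.toLinearMap b,
        (subQuotEquiv σ hB P).finrank_eq.symm ▸ map_mem_exteriorPower _ b.2⟩
      ((detEquiv (subQuotEquiv σ hA P)).symm a') ((detEquiv (subQuotEquiv σ hB P)).symm b')
      ((detEquiv (subQuotEquiv σ hA Q)).symm pa) ((detEquiv (subQuotEquiv σ hB Q)).symm pb)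
      ((congrArg _ ha).trans (map_subQuotMap_symm σ hA hA le_rfl le_rfl hQP _))
      ((congrArg _ hb).trans (map_subQuotMap_symm σ hB hB le_rfl le_rfl hQP _))
      (((congrArg _ hpa).trans (map_mul _ _ _)).trans (congrArg (· * _)
        (map_subQuotMap_symm σ hP hA (hAP.comap σ hA).le hAP.le le_rfl _)))
      (((congrArg _ hpb).trans (map_mul _ _ _)).trans (congrArg (· * _)
        (map_subQuotMap_symm σ hP hB (hBP.comap σ hB).le hBP.le le_rfl _)))
      ((LinearEquiv.eq_symm_apply (detEquiv (subQuotEquiv σ hB P))).2 h)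
    exact (LinearEquiv.eq_symm_apply (detEquiv (subQuotEquiv σ hB Q))).1 key

/-- The underlying set of the restricted general linear group: the automorphisms `σ` of `V`
with `V₊ ∼ σ V₊`. -/
def restrictedGL (Vp : Submodule k V) : Set (V ≃ₗ[k] V) :=
  {σ | Commensurable Vp (Vp.map (σ : V →ₗ[k] V))}

/-- The objects of the determinant groupoid of `V₊`: the free submodules commensurable
to `V₊`. -/
structure IsObj (Vp A : Submodule k V) : Prop where
  free : Module.Free k A
  comm : Commensurable A Vp

/-- The central extension of the restricted general linear group: pairs of an automorphism `σ` in
that group and a natural transformation `Φ` from the identity functor of the determinant groupoid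
to `σ_*`. Naturality: `Φ B ∘ α = σ_* α ∘ Φ A` for all `α` in `Det(A, B)`. -/
@[ext]
structure CentralExt (Vp : Submodule k V) where
  σ : V ≃ₗ[k] V
  mem : σ ∈ restrictedGL Vp
  Φ : ∀ A : Submodule k V, IsObj Vp A → DetHom A (A.map (σ : V →ₗ[k] V))
  natural : ∀ (A B : Submodule k V) (hA : IsObj Vp A) (hB : IsObj Vp B) (α : DetHom A B)
    (γ : DetHom A (B.map (σ : V →ₗ[k] V))),
    IsComp α (Φ B hB) γ ↔ IsComp (Φ A hA) (α.push σ rfl rfl) γ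

theorem IsComp.smul_left {A B C : Submodule k V} {α : DetHom A B} {β : DetHom B C}
    {γ : DetHom A C} (c : kˣ) (h : IsComp α β γ) : IsComp (α.smul c) β (γ.smul c) := by
  intro P hA hB hC x
  change c • γ.app P hA hC x = β.app P hB hC (c • α.app P hA hB x)
  rw [h P hA hB hC x, Units.smul_def, Units.smul_def, map_smul]

theorem IsComp.smul_right {A B C : Submodule k V} {α : DetHom A B} {β : DetHom B C}
    {γ : DetHom A C} (c : kˣ) (h : IsComp α β γ) : IsComp α (β.smul c) (γ.smul c) := by
  intro P hA hB hC x
  change c • γ.app P hA hC x = c • β.app P hB hC (α.app P hA hB x)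
  rw [h P hA hB hC x]

theorem DetHom.smul_smul_inv {A B : Submodule k V} (c : kˣ) (α : DetHom A B) :
    (α.smul c⁻¹).smul c = α := by
  refine DetHom.ext (funext fun P => funext fun hA => funext fun hB => LinearEquiv.ext fun x => ?_)
  exact _root_.smul_inv_smul c (α.app P hA hB x)

theorem DetHom.smul_inv_smul {A B : Submodule k V} (c : kˣ) (α : DetHom A B) :
    (α.smul c).smul c⁻¹ = α := by
  simpa using α.smul_smul_inv c⁻¹

/-- `c · (σ, Φ) = (σ, c · Φ)`, the product with the central element `(1, A ↦ c · 1_A)`. -/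
def CentralExt.smul {Vp : Submodule k V} (c : kˣ) (s : CentralExt Vp) : CentralExt Vp where
  σ := s.σ
  mem := s.mem
  Φ A hA := (s.Φ A hA).smul c
  natural A B hA hB α γ := by
    constructor
    · intro h
      have h1 := h.smul_right c⁻¹
      rw [DetHom.smul_inv_smul] at h1
      have h2 := ((s.natural A B hA hB α _).1 h1).smul_left c
      rwa [DetHom.smul_smul_inv] at h2
    · intro h
      have h1 := h.smul_left c⁻¹
      rw [DetHom.smul_inv_smul] at h1
      have h2 := ((s.natural A B hA hB α _).2 h1).smul_right c
      rwa [DetHom.smul_smul_inv] at h2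

/-- `u = s t` in the central extension, where
`(σ₁, Φ₁) (σ₂, Φ₂) = (σ₁ σ₂, A ↦ σ₁_* (Φ₂ A) ∘ Φ₁ A)`. -/
def IsProd {Vp : Submodule k V} (s t u : CentralExt Vp) : Prop :=
  ∃ hu : u.σ = s.σ * t.σ, ∀ (A : Submodule k V) (hA : IsObj Vp A),
    IsComp (s.Φ A hA)
      ((t.Φ A hA).push s.σ rfl (by rw [hu, ← Submodule.map_comp]; rfl)) (u.Φ A hA)

/-- The commutator `s t s⁻¹ t⁻¹` is the element `c` of `kˣ`, that is, `s t = c · (t s)`. -/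
def IsCommutator {Vp : Submodule k V} (s t : CentralExt Vp) (c : kˣ) : Prop :=
  ∃ u v : CentralExt Vp, IsProd s t u ∧ IsProd t s v ∧ u = v.smul c

/-- `c` is the commutator of liftings of `σ` and `τ` to the central extension: such liftings
exist, and all of them have commutator `c`. -/
def IsSymbol (Vp : Submodule k V) (σ τ : V ≃ₗ[k] V) (c : kˣ) : Prop :=
  (∃ s : CentralExt Vp, s.σ = σ) ∧ (∃ t : CentralExt Vp, t.σ = τ) ∧
    ∀ s t : CentralExt Vp, s.σ = σ → t.σ = τ → IsCommutator s t c

/-- The symbol of `σ` and `τ` with respect to `V₊`: the element `c` of `kˣ` with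
`IsSymbol Vp σ τ c`. -/
def symbol (Vp : Submodule k V) (σ τ : V ≃ₗ[k] V) : kˣ :=
  Classical.epsilon (IsSymbol Vp σ τ)

end DetGroupoid

end

/-!
Over an artinian local ring a free submodule `P` of a free module `A` stays injective modulo the
maximal ideal, since the socle is nonzero; hence a finitely generated `A/P` is free
(`free_quotient_of_free`). So the levels `P` at which `Det(A, B)` is computed form a downward
directed set, nonempty for commensurable `A` and `B`. With respect to bases, the cancellation rule
says that two isomorphisms of determinants have the same coordinate (`cancels_iff`). Therefore the
transition maps are bijections, `Det(A, B)` is a `kˣ`-torsor, and an identity between elements of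
`Det(A, B)` may be checked at a single level (`DetHom.eq_of_app_eq`).

The symbol at `V₊` is the element `c` with `σ_* β ∘ α = c · (τ_* α ∘ β)` for any `α` in
`Det(V₊, σ V₊)` and `β` in `Det(V₊, τ V₊)` (`IsRatio`): rescaling `α` or `β` changes both sides
alike, and a natural transformation is determined by its value at one object.

The two symbols are compared through a pairing. If `V = A ⊕ B = A' ⊕ B'`, and `P ≤ A ⊓ A'` and
`Q ≤ B ⊓ B'` are levels, then `det (A/P) ⊗ det (B/Q)` and `det (A'/P) ⊗ det (B'/Q)` are both the
determinant of `V / (P + Q)`. So elements `α` of `Det(A, A')` and `β` of `Det(B, B')` have a pairing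
in `kˣ` (`Pairs`), which is multiplicative under composition and invariant under automorphisms of
`V`. Changing the level costs a sign (`Pairs.cancels`), because the exterior algebra is graded
commutative. As a consequence `σ_*` changes the pairing at a fixed level by the sign of the product
of the index of `σ` and the index of `α` (`pairs_push`).

Pairing the identities that define the symbols `c` at `V₊` and `d` at `V₋` expresses `c * d` as a
quotient of two such signs. For `σ_*` acting on elements over `τ` and for `τ_*` acting on elements
over `σ` the exponent is the product of the indices of `σ` and `τ` up to parity, so the signs agree
and `c * d = 1` (`IsRatio.mul_eq_one`).
-/

noncomputable section

namespace DetGroupoid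

/-! ### Exterior algebras and generators of determinants -/

section Exterior

variable {k : Type*} [CommRing k]

/-- `x` is a free generator of the module `L` of rank one. -/
def IsGenerator (k : Type*) [CommRing k] {L : Type*} [AddCommGroup L] [Module k L] (x : L) : Prop :=
  Function.Bijective fun c : k => c • x

section Generator

variable {L L' : Type*} [AddCommGroup L] [Module k L] [AddCommGroup L'] [Module k L']

theorem IsGenerator.exists_smul {x : L} (hx : IsGenerator k x) (y : L) : ∃ c : k, c • x = y :=
  hx.2 y

theorem IsGenerator.smul_inj {x : L} (hx : IsGenerator k x) {c d : k} (h : c • x = d • x) :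
    c = d :=
  hx.1 h

theorem IsGenerator.exists_unit_smul {x y : L} (hx : IsGenerator k x) (hy : IsGenerator k y) :
    ∃ c : kˣ, c • x = y := by
  obtain ⟨c, hc⟩ := hx.exists_smul y
  obtain ⟨d, hd⟩ := hy.exists_smul x
  have h1 : c * d = 1 := hy.smul_inj (by rw [mul_smul, hd, hc, one_smul])
  exact ⟨Units.mkOfMulEqOne c d h1, hc⟩

theorem IsGenerator.unit_smul {x : L} (hx : IsGenerator k x) (c : kˣ) : IsGenerator k (c • x) := by
  refine ⟨fun a b h => ?_, fun y => ?_⟩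
  · have h' : (a * c) • x = (b * c) • x := by simpa [mul_smul, Units.smul_def] using h
    exact c.mul_left_inj.1 (hx.smul_inj h')
  · obtain ⟨d, rfl⟩ := hx.exists_smul y
    refine ⟨d * (c⁻¹ : kˣ), ?_⟩
    simp [mul_smul, ← Units.smul_def]

theorem IsGenerator.map {x : L} (hx : IsGenerator k x) (e : L ≃ₗ[k] L') :
    IsGenerator k (e x) := by
  have : (fun c : k => c • e x) = e ∘ fun c : k => c • x := by
    ext c
    simp
  unfold IsGenerator
  rw [this]
  exact e.bijective.comp hx

/-- The isomorphism of modules of rank one that matches given generators. -/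
def IsGenerator.equiv {x : L} {y : L'} (hx : IsGenerator k x) (hy : IsGenerator k y) :
    L ≃ₗ[k] L' :=
  have hx' : Function.Bijective (LinearMap.toSpanSingleton k L x) := hx
  have hy' : Function.Bijective (LinearMap.toSpanSingleton k L' y) := hy
  (LinearEquiv.ofBijective _ hx').symm.trans (LinearEquiv.ofBijective _ hy')

theorem IsGenerator.equiv_apply {x : L} {y : L'} (hx : IsGenerator k x) (hy : IsGenerator k y) :
    hx.equiv hy x = y := by
  have hx' : Function.Bijective (LinearMap.toSpanSingleton k L x) := hx
  have h1 : (LinearEquiv.ofBijective _ hx').symm x = 1 := by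
    rw [LinearEquiv.symm_apply_eq, LinearEquiv.ofBijective_apply,
      LinearMap.toSpanSingleton_apply, one_smul]
  change LinearMap.toSpanSingleton k L' y ((LinearEquiv.ofBijective _ hx').symm x) = y
  rw [h1, LinearMap.toSpanSingleton_apply, one_smul]

theorem IsGenerator.equiv_ext {x : L} (hx : IsGenerator k x) {e e' : L ≃ₗ[k] L'}
    (h : e x = e' x) : e = e' := by
  ext y
  obtain ⟨c, rfl⟩ := hx.exists_smul y
  simp [h]

end Generator

variable {M N K L : Type*} [AddCommGroup M] [Module k M] [AddCommGroup N] [Module k N]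
  [AddCommGroup K] [Module k K] [AddCommGroup L] [Module k L]

theorem isGenerator_of_basis [Nontrivial k] {n : ℕ} (b : Module.Basis (Fin n) k M)
    {z : DetLine k M}
    (hz : (z : ExteriorAlgebra k M) = ExteriorAlgebra.ιMulti k n b) : IsGenerator k z := by
  have hn : n = Module.finrank k M := by simp [Module.finrank_eq_card_basis b]
  subst hn
  have hz' : z = exteriorPower.ιMulti k _ b := Subtype.ext hz
  set d := exteriorPower.alternatingMapLinearEquiv b.det with hd
  have hdz : d z = 1 := by
    rw [hz', hd, exteriorPower.alternatingMapLinearEquiv_apply_ιMulti, b.det_self]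
  -- The determinant `d` inverts `c ↦ c • z`: alternating maps agree if they do so on the basis.
  have hid : (LinearMap.toSpanSingleton k _ z) ∘ₗ d = LinearMap.id := by
    refine exteriorPower.linearMap_ext ?_
    refine Module.Basis.ext_alternating b fun v hv => ?_
    obtain ⟨σ, rfl⟩ : ∃ σ : Equiv.Perm (Fin (Module.finrank k M)), v = σ :=
      ⟨Equiv.ofBijective v (Finite.injective_iff_bijective.1 hv), rfl⟩
    have e1 := AlternatingMap.map_perm
      (((LinearMap.toSpanSingleton k _ z) ∘ₗ d).compAlternatingMap
        (exteriorPower.ιMulti k (Module.finrank k M))) b σ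
    have e2 := AlternatingMap.map_perm
      ((LinearMap.id (R := k) (M := DetLine k M)).compAlternatingMap
        (exteriorPower.ιMulti k (Module.finrank k M))) b σ
    refine (e1.trans ?_).trans e2.symm
    congr 1
    simp [← hz', hdz]
  refine ⟨fun a c h => ?_, fun y => ⟨d y, LinearMap.congr_fun hid y⟩⟩
  have := congrArg d h
  simpa [hdz] using this

theorem exists_isGenerator_detLine (k : Type*) [CommRing k] [Nontrivial k] (M : Type*)
    [AddCommGroup M] [Module k M] [Module.Free k M] [Module.Finite k M] :
    ∃ x : DetLine k M, IsGenerator k x :=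
  ⟨exteriorPower.ιMulti k _ (Module.finBasis k M), isGenerator_of_basis (Module.finBasis k M) rfl⟩

theorem map_mul_map_mem (f : K →ₗ[k] M) (g : L →ₗ[k] M) {m n : ℕ} {x : ExteriorAlgebra k K}
    {y : ExteriorAlgebra k L} (hx : x ∈ ⋀[k]^m K) (hy : y ∈ ⋀[k]^n L) :
    ExteriorAlgebra.map f x * ExteriorAlgebra.map g y ∈ ⋀[k]^(m + n) M := by
  rw [ExteriorAlgebra.exteriorPower, pow_add]
  exact Submodule.mul_mem_mul (map_mem_exteriorPower f hx) (map_mem_exteriorPower g hy)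

theorem finrank_of_coprod_bijective [Nontrivial k] [Module.Free k K] [Module.Finite k K]
    [Module.Free k L] [Module.Finite k L] {f : K →ₗ[k] M} {g : L →ₗ[k] M}
    (h : Function.Bijective (f.coprod g)) :
    Module.finrank k M = Module.finrank k K + Module.finrank k L := by
  rw [← (LinearEquiv.ofBijective _ h).finrank_eq, Module.finrank_prod]

/-- Along a decomposition `K × L ≃ M`, generators of `det K` and `det L` multiply to a generator
of `det M`. -/
theorem IsGenerator.mul [Nontrivial k] [Module.Free k K] [Module.Finite k K]
    [Module.Free k L] [Module.Finite k L] {f : K →ₗ[k] M} {g : L →ₗ[k] M}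
    (h : Function.Bijective (f.coprod g)) {x : DetLine k K} {y : DetLine k L} {z : DetLine k M}
    (hx : IsGenerator k x) (hy : IsGenerator k y)
    (hz : (z : ExteriorAlgebra k M) = ExteriorAlgebra.map f x * ExteriorAlgebra.map g y) :
    IsGenerator k z := by
  let bK := Module.finBasis k K
  let bL := Module.finBasis k L
  obtain ⟨c, rfl⟩ := (isGenerator_of_basis bK (z := exteriorPower.ιMulti k _ bK)
    rfl).exists_unit_smul hx
  obtain ⟨d, rfl⟩ := (isGenerator_of_basis bL (z := exteriorPower.ιMulti k _ bL)
    rfl).exists_unit_smul hy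
  let b := ((bK.prod bL).map (LinearEquiv.ofBijective _ h)).reindex finSumFinEquiv
  have hb : ⇑b = Fin.append (f ∘ bK) (g ∘ bL) := by
    ext i
    induction i using Fin.addCases <;> simp [b]
  have hz' : ((((c * d)⁻¹ : kˣ) • z : DetLine k M) : ExteriorAlgebra k M) =
      ExteriorAlgebra.ιMulti k _ b := by
    rw [hb, ← ExteriorAlgebra.ιMulti_mul_ιMulti, ← ExteriorAlgebra.map_apply_ιMulti,
      ← ExteriorAlgebra.map_apply_ιMulti]
    rw [Units.smul_def, Submodule.coe_smul, hz]
    simp only [Units.smul_def, Submodule.coe_smul, map_smul, smul_mul_smul_comm, smul_smul,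
      exteriorPower.ιMulti_apply_coe]
    rw [← Units.val_mul, ← Units.val_mul, inv_mul_cancel, Units.val_one, one_smul]
  have := (isGenerator_of_basis b hz').unit_smul (c * d)
  rwa [_root_.smul_inv_smul] at this

/-- A vector can be moved to the front of a product at the cost of changing the other factor. -/
theorem exists_mul_ι_eq (w : ExteriorAlgebra k M) (y : M) :
    ∃ w', w * ExteriorAlgebra.ι k y = ExteriorAlgebra.ι k y * w' := by
  induction w using ExteriorAlgebra.induction with
  | algebraMap r => exact ⟨_, Algebra.commutes r _⟩
  | ι x =>
    refine ⟨-ExteriorAlgebra.ι k x, ?_⟩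
    rw [mul_neg, eq_neg_iff_add_eq_zero]
    exact ExteriorAlgebra.ι_add_mul_swap x y
  | mul a b ha hb =>
    obtain ⟨a', ha⟩ := ha
    obtain ⟨b', hb⟩ := hb
    exact ⟨a' * b', by rw [mul_assoc, hb, ← mul_assoc, ha, mul_assoc]⟩
  | add a b ha hb =>
    obtain ⟨a', ha⟩ := ha
    obtain ⟨b', hb⟩ := hb
    exact ⟨a' + b', by rw [add_mul, ha, hb, mul_add]⟩

/-- If `x` annihilates the kernel of a split surjection `π`, then `x ∧ a` depends only on the
image of `a` under `π`. -/
theorem mul_eq_mul_of_map_eq {π : M →ₗ[k] N} {s : N →ₗ[k] M} (hs : π ∘ₗ s = LinearMap.id)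
    {x : ExteriorAlgebra k M} (hx : ∀ y, π y = 0 → x * ExteriorAlgebra.ι k y = 0)
    {a b : ExteriorAlgebra k M} (h : ExteriorAlgebra.map π a = ExteriorAlgebra.map π b) :
    x * a = x * b := by
  -- Left multiples `x * w` also annihilate the kernel, which lets the induction on `a` run.
  have hx' : ∀ w y, π y = 0 → x * w * ExteriorAlgebra.ι k y = 0 := fun w y hy => by
    obtain ⟨w', hw⟩ := exists_mul_ι_eq w y
    rw [mul_assoc, hw, ← mul_assoc, hx y hy, zero_mul]
  have key : ∀ (a x : ExteriorAlgebra k M),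
      (∀ w y, π y = 0 → x * w * ExteriorAlgebra.ι k y = 0) →
      x * a = x * ExteriorAlgebra.map (s ∘ₗ π) a := by
    intro a
    induction a using ExteriorAlgebra.induction with
    | algebraMap r => simp
    | ι y =>
      intro x hx
      have : π (y - s (π y)) = 0 := by
        rw [map_sub, sub_eq_zero]
        exact (LinearMap.congr_fun hs (π y)).symm
      have h1 := hx 1 _ this
      rw [mul_one, map_sub, mul_sub, sub_eq_zero] at h1
      simpa using h1
    | mul a b ha hb =>
      intro x hx
      rw [← mul_assoc, ha x hx, map_mul, ← mul_assoc]
      refine hb _ fun w y hy => ?_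
      rw [mul_assoc x]
      exact hx _ y hy
    | add a b ha hb =>
      intro x hx
      rw [mul_add, ha x hx, hb x hx, map_add, mul_add]
  rw [key a x hx', key b x hx', ← map_map, ← map_map, h]

/-- A top form is annihilated by vectors. -/
theorem detLine_mul_ι_eq_zero [Nontrivial k] [Module.Free k M] [Module.Finite k M]
    (p : DetLine k M) (y : M) : (p : ExteriorAlgebra k M) * ExteriorAlgebra.ι k y = 0 := by
  have hmem : (p : ExteriorAlgebra k M) * ExteriorAlgebra.ι k y ∈
      ⋀[k]^(Module.finrank k M + 1) M := by
    rw [ExteriorAlgebra.exteriorPower, pow_succ]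
    exact Submodule.mul_mem_mul p.2 ⟨y, rfl⟩
  have h0 : Module.finrank k (⋀[k]^(Module.finrank k M + 1) M) = 0 := by
    rw [exteriorPower.finrank_eq, Nat.choose_succ_self]
  have : Subsingleton (⋀[k]^(Module.finrank k M + 1) M) :=
    Module.finrank_eq_zero_iff_of_free _ _ |>.1 h0
  exact congrArg Subtype.val (Subsingleton.elim (⟨_, hmem⟩ : ⋀[k]^(Module.finrank k M + 1) M) 0)

theorem ι_mul_eq_neg_one_pow_mul {m : ℕ} {x : ExteriorAlgebra k M} (hx : x ∈ ⋀[k]^m M) (y : M) :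
    ExteriorAlgebra.ι k y * x = (-1) ^ m * (x * ExteriorAlgebra.ι k y) := by
  induction hx using Submodule.pow_induction_on_left' with
  | algebraMap r => simpa using (Algebra.commutes r (ExteriorAlgebra.ι k y)).symm
  | add a b i _ _ ha hb => rw [mul_add, ha, hb, add_mul, mul_add]
  | mem_mul z hz i a _ ha =>
    obtain ⟨z, rfl⟩ := hz
    have h1 := ExteriorAlgebra.ι_add_mul_swap (R := k) y z
    rw [← mul_assoc, eq_neg_of_add_eq_zero_left h1, neg_mul, mul_assoc, ha, pow_succ]
    have h2 := ((Commute.neg_one_left (ExteriorAlgebra.ι k z)).pow_left i).eq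
    rw [← mul_assoc (ExteriorAlgebra.ι k z), ← h2]
    simp only [mul_neg, neg_mul, mul_one, mul_assoc]

/-- Graded commutativity of the exterior algebra. -/
theorem mul_eq_neg_one_pow_mul {m n : ℕ} {x y : ExteriorAlgebra k M} (hx : x ∈ ⋀[k]^m M)
    (hy : y ∈ ⋀[k]^n M) : x * y = (-1) ^ (m * n) * (y * x) := by
  induction hy using Submodule.pow_induction_on_left' with
  | algebraMap r => simpa using (Algebra.commutes r x).symm
  | add a b i _ _ ha hb => rw [mul_add, ha, hb, add_mul, mul_add]
  | mem_mul z hz i a _ ha =>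
    obtain ⟨z, rfl⟩ := hz
    have h1 := ι_mul_eq_neg_one_pow_mul hx z
    have h2 : x * ExteriorAlgebra.ι k z = (-1) ^ m * (ExteriorAlgebra.ι k z * x) := by
      rw [h1, ← mul_assoc, ← pow_add, Even.neg_one_pow ⟨m, rfl⟩, one_mul]
    rw [← mul_assoc, h2, mul_assoc, mul_assoc, ha, Nat.mul_succ, add_comm, pow_add]
    have h3 := ((Commute.neg_one_left (ExteriorAlgebra.ι k z)).pow_left (m * i)).eq
    rw [← mul_assoc (ExteriorAlgebra.ι k z), ← h3]
    simp only [mul_assoc]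

end Exterior

/-! ### Free submodules over an artinian local ring -/

section Free

open IsLocalRing TensorProduct

/-- The socle of an artinian local ring is nonzero. -/
theorem exists_ne_zero_mul_maximalIdeal_eq_zero (k : Type*) [CommRing k] [IsLocalRing k]
    [IsArtinianRing k] : ∃ s : k, s ≠ 0 ∧ ∀ a ∈ maximalIdeal k, s * a = 0 := by
  classical
  have hn : ∃ n, maximalIdeal k ^ n = ⊥ :=
    (isArtinianRing_iff_isNilpotent_maximalIdeal k).1 inferInstance
  obtain ⟨m, hm⟩ : ∃ m, Nat.find hn = m + 1 := Nat.exists_eq_succ_of_ne_zero fun h0 => by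
    have := Nat.find_spec hn
    rw [h0, pow_zero, Ideal.one_eq_top] at this
    exact top_ne_bot this
  obtain ⟨s, hs, hs0⟩ := Submodule.exists_mem_ne_zero_of_ne_bot
    (Nat.find_min hn (hm ▸ Nat.lt_succ_self m : m < Nat.find hn))
  refine ⟨s, hs0, fun a ha => ?_⟩
  have : s * a ∈ maximalIdeal k ^ (m + 1) := by
    rw [pow_succ]
    exact Ideal.mul_mem_mul hs ha
  rwa [← hm, Nat.find_spec hn] at this

variable {k : Type*} [CommRing k]

/-- A split short exact sequence is a decomposition of its middle term. -/
theorem exists_section_of_exact {K M L : Type*} [AddCommGroup K] [Module k K] [AddCommGroup M]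
    [Module k M] [AddCommGroup L] [Module k L] [Module.Projective k L] {i : K →ₗ[k] M}
    {π : M →ₗ[k] L} (hi : Function.Injective i) (hπ : Function.Surjective π)
    (h : Function.Exact i π) :
    ∃ s : L →ₗ[k] M, π ∘ₗ s = LinearMap.id ∧ Function.Bijective (i.coprod s) := by
  obtain ⟨s, hs⟩ := Module.projective_lifting_property π LinearMap.id hπ
  have hs' : ∀ x, π (s x) = x := LinearMap.congr_fun hs
  have hi0 : ∀ x, π (i x) = 0 := h.apply_apply_eq_zero
  refine ⟨s, hs, (injective_iff_map_eq_zero _).2 ?_, fun m => ?_⟩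
  · rintro ⟨x, y⟩ hxy
    replace hxy : i x + s y = 0 := hxy
    have hy : y = 0 := by simpa [hi0, hs'] using congrArg π hxy
    subst hy
    rw [map_zero, add_zero] at hxy
    rw [hi (hxy.trans (map_zero i).symm)]
    rfl
  · obtain ⟨x, hx⟩ := (h (m - s (π m))).1 (by rw [map_sub, hs', sub_self])
    exact ⟨(x, π m), by simp [hx]⟩

/-- Over an artinian local ring, a free submodule `N` of a free module stays injective modulo the
maximal ideal, because a nonzero element of the socle detects coordinates that are units. -/
theorem lTensor_subtype_injective [IsLocalRing k] [IsArtinianRing k] {M : Type*} [AddCommGroup M]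
    [Module k M] (N : Submodule k M) [Module.Free k N] :
    Function.Injective (N.subtype.lTensor (k ⧸ maximalIdeal k)) := by
  obtain ⟨s, hs0, hs⟩ := exists_ne_zero_mul_maximalIdeal_eq_zero k
  rw [injective_iff_map_eq_zero]
  intro z hz
  obtain ⟨x, rfl⟩ := TensorProduct.mk_surjective k N (k ⧸ maximalIdeal k)
    Ideal.Quotient.mk_surjective z
  have hx : (x : M) ∈ maximalIdeal k • (⊤ : Submodule k M) := by
    rw [← LinearMap.ker_tensorProductMk]
    exact hz
  have hsx : ∀ m ∈ maximalIdeal k • (⊤ : Submodule k M), s • m = 0 := by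
    intro m hm
    induction hm using Submodule.smul_induction_on' with
    | smul a ha m _ => rw [smul_smul, hs a ha, zero_smul]
    | add _ _ _ _ h1 h2 => rw [smul_add, h1, h2, add_zero]
  have hsx' : s • x = 0 := Subtype.ext (hsx _ hx)
  let b := Module.Free.chooseBasis k N
  have hc : ∀ j, b.repr x j ∈ maximalIdeal k := fun j hu => by
    have h0 : s * b.repr x j = 0 := by
      rw [← smul_eq_mul, ← Finsupp.smul_apply, ← map_smul, hsx', map_zero, Finsupp.zero_apply]
    exact hs0 ((hu.mul_left_eq_zero).1 h0)
  have hxN : x ∈ maximalIdeal k • (⊤ : Submodule k N) := by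
    rw [← b.linearCombination_repr x, Finsupp.linearCombination_apply]
    exact Submodule.sum_mem _ fun j _ => Submodule.smul_mem_smul (hc j) trivial
  rw [← LinearMap.ker_tensorProductMk] at hxN
  exact hxN

/-- Over an artinian local ring, a finitely generated quotient of a free module by a free submodule
is free. -/
theorem free_quotient_of_free [IsLocalRing k] [IsArtinianRing k] {M : Type*} [AddCommGroup M]
    [Module k M] [Module.Free k M] (N : Submodule k M) [Module.Free k N] [Module.Finite k (M ⧸ N)] :
    Module.Free k (M ⧸ N) := by
  have : Module.FinitePresentation k (M ⧸ N) := Module.finitePresentation_of_finite k _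
  apply Module.free_of_maximalIdeal_rTensor_injective
  rw [← LinearMap.lTensor_inj_iff_rTensor_inj]
  exact lTensor_injective_of_exact_of_exact_of_rTensor_injective
    (LinearMap.exact_subtype_mkQ N) (Submodule.mkQ_surjective _)
    (LinearMap.exact_subtype_mkQ (maximalIdeal k)) (Submodule.mkQ_surjective _)
    ((LinearMap.lTensor_inj_iff_rTensor_inj _ _).mp (lTensor_subtype_injective N))
    (Module.Flat.lTensor_preserves_injective_linearMap _ Subtype.val_injective)

/-- A submodule of finite colength in a free module contains a free direct summand whose complement
is free of finite rank. -/
theorem exists_free_le_of_finite_quotient [Nontrivial k] {M : Type*} [AddCommGroup M] [Module k M]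
    [Module.Free k M] (N : Submodule k M) [Module.Finite k (M ⧸ N)] :
    ∃ P ≤ N, Module.Free k P ∧ Module.Free k (M ⧸ P) ∧ Module.Finite k (M ⧸ P) := by
  classical
  let e := Module.Free.chooseBasis k M
  have htop : Submodule.span k (Set.range (N.mkQ ∘ e)) = ⊤ := by
    rw [Set.range_comp, ← Submodule.map_span, e.span_eq, Submodule.map_top, Submodule.range_mkQ]
  obtain ⟨T, hT, hTspan⟩ := (Submodule.fg_span_iff_fg_span_finset_subset _).1
    (htop ▸ Module.Finite.fg_top : (Submodule.span k (Set.range (N.mkQ ∘ e))).FG)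
  obtain ⟨S, rfl⟩ : ∃ S : Finset (Module.Free.ChooseBasisIndex k M), T = S.image (N.mkQ ∘ e) := by
    obtain ⟨S, -, hS⟩ := Finset.subset_set_image_iff.1 (Set.image_univ ▸ hT)
    exact ⟨S, hS.symm⟩
  set I : Set (Module.Free.ChooseBasisIndex k M) := ↑S with hI
  let F := Submodule.span k (e '' I)
  have hF : Submodule.map N.mkQ F = ⊤ := by
    rw [Submodule.map_span, ← Set.image_comp, ← htop, hTspan, Finset.coe_image]
  have hFG : IsCompl F (Submodule.span k (e '' Iᶜ)) :=
    e.linearIndependent.isCompl_span_image e.span_eq isCompl_compl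
  have hfree : ∀ T : Set (Module.Free.ChooseBasisIndex k M),
      Module.Free k (Submodule.span k (e '' T)) := fun T => by
    rw [Set.image_eq_range]
    exact Module.Free.of_basis (Module.Basis.span
      (e.linearIndependent.comp (Subtype.val : T → _) Subtype.val_injective))
  have hFfin : Module.Finite k F :=
    Module.Finite.span_of_finite k (S.finite_toSet.image e)
  have hFfree : Module.Free k F := hfree I
  have hlift : ∀ m : M, ∃ f : F, N.mkQ f = N.mkQ m := fun m => by
    obtain ⟨f, hf, h⟩ : N.mkQ m ∈ Submodule.map N.mkQ F := hF ▸ trivial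
    exact ⟨⟨f, hf⟩, h⟩
  choose r hr using hlift
  -- `φ` is a projection onto `F` that does not change classes modulo `N`; its kernel is sought.
  let φ : M →ₗ[k] F := e.constr k fun i =>
    if h : i ∈ I then ⟨e i, Submodule.subset_span ⟨i, h, rfl⟩⟩ else r (e i)
  have hφF : ∀ x : F, φ x = x := by
    rintro ⟨x, hx⟩
    refine Subtype.ext ?_
    induction hx using Submodule.span_induction with
    | mem x hx =>
      obtain ⟨i, hi, rfl⟩ := hx
      simp [φ, hi]
    | zero => simp
    | add x y _ _ h1 h2 => simpa using congrArg₂ (· + ·) h1 h2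
    | smul a x _ h => simpa using congrArg (a • ·) h
  have hφN : N.mkQ ∘ₗ F.subtype ∘ₗ φ = N.mkQ := by
    refine e.ext fun i => ?_
    by_cases hi : i ∈ I
    · simp [φ, hi]
    · simpa [φ, hi] using hr (e i)
  have hc := LinearMap.isCompl_of_proj hφF
  have : Module.Free k (Submodule.span k (e '' Iᶜ)) := hfree _
  refine ⟨LinearMap.ker φ, fun x hx => ?_, ?_, ?_, ?_⟩
  · rw [← Submodule.ker_mkQ N, LinearMap.mem_ker, ← hφN]
    simp [LinearMap.mem_ker.1 hx]
  · exact Module.Free.of_equiv ((Submodule.quotientEquivOfIsCompl _ _ hFG).symm.trans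
      (Submodule.quotientEquivOfIsCompl _ _ hc))
  · exact Module.Free.of_equiv (Submodule.quotientEquivOfIsCompl _ _ hc.symm).symm
  · exact Module.Finite.equiv (Submodule.quotientEquivOfIsCompl _ _ hc.symm).symm

end Free

section SubQuot

variable {k : Type*} [CommRing k] {V : Type*} [AddCommGroup V] [Module k V]

theorem subQuotMap_mk {A B P Q : Submodule k V} (hAB : A ≤ B) (hPQ : P ≤ Q) (x : A) :
    subQuotMap hAB hPQ (Submodule.Quotient.mk x) =
      Submodule.Quotient.mk (Submodule.inclusion hAB x) :=
  rfl

theorem subQuot_mk_eq_zero {A P : Submodule k V} {x : A} :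
    (Submodule.Quotient.mk x : SubQuot A P) = 0 ↔ (x : V) ∈ P := by
  rw [Submodule.Quotient.mk_eq_zero]
  rfl

theorem subQuotMap_injective {A B P : Submodule k V} (hAB : A ≤ B) :
    Function.Injective (subQuotMap hAB (le_refl P)) := by
  rw [injective_iff_map_eq_zero]
  intro x hx
  obtain ⟨x, rfl⟩ := Submodule.Quotient.mk_surjective _ x
  rw [subQuotMap_mk, subQuot_mk_eq_zero] at hx
  exact subQuot_mk_eq_zero.2 hx

theorem subQuotMap_surjective {A P Q : Submodule k V} (hPQ : P ≤ Q) :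
    Function.Surjective (subQuotMap (le_refl A) hPQ) := by
  intro x
  obtain ⟨x, rfl⟩ := Submodule.Quotient.mk_surjective _ x
  exact ⟨Submodule.Quotient.mk x, rfl⟩

theorem subQuotMap_exact {A P Q : Submodule k V} (hQP : Q ≤ P) (hPA : P ≤ A) :
    Function.Exact (subQuotMap hPA (le_refl Q)) (subQuotMap (le_refl A) hQP) := by
  intro x
  obtain ⟨x, rfl⟩ := Submodule.Quotient.mk_surjective _ x
  rw [subQuotMap_mk, subQuot_mk_eq_zero]
  constructor
  · intro h
    exact ⟨Submodule.Quotient.mk ⟨x, h⟩, rfl⟩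
  · rintro ⟨y, hy⟩
    obtain ⟨y, rfl⟩ := Submodule.Quotient.mk_surjective _ y
    rw [subQuotMap_mk, ← sub_eq_zero, ← Submodule.Quotient.mk_sub, subQuot_mk_eq_zero] at hy
    have h : (y : V) - (y - x) ∈ P := P.sub_mem y.2 (hQP hy)
    simpa using h

theorem exists_section_subQuot {A P Q : Submodule k V} (hQP : Q ≤ P) (hAP : Admissible A P) :
    ∃ s : SubQuot A P →ₗ[k] SubQuot A Q, subQuotMap le_rfl hQP ∘ₗ s = LinearMap.id ∧
      Function.Bijective ((subQuotMap hAP.le (le_refl Q)).coprod s) := by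
  have := hAP.free_quot
  exact exists_section_of_exact (subQuotMap_injective _) (subQuotMap_surjective _)
    (subQuotMap_exact hQP hAP.le)

theorem Admissible.free_left {A P : Submodule k V} (h : Admissible A P) : Module.Free k A := by
  have := h.free
  have := h.free_quot
  have hP : Module.Free k (P.submoduleOf A) :=
    Module.Free.of_equiv (Submodule.submoduleOfEquivOfLe h.le).symm
  obtain ⟨s, -, hs⟩ := exists_section_of_exact (Submodule.subtype_injective (P.submoduleOf A))
    (Submodule.mkQ_surjective _) (LinearMap.exact_subtype_mkQ _)
  exact Module.Free.of_equiv (LinearEquiv.ofBijective _ hs)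

theorem Admissible.trans {A P Q : Submodule k V} (hAP : Admissible A P) (hPQ : Admissible P Q) :
    Admissible A Q := by
  obtain ⟨s, -, hs⟩ := exists_section_subQuot hPQ.le hAP
  have := hAP.free_quot
  have := hAP.finite_quot
  have := hPQ.free_quot
  have := hPQ.finite_quot
  exact ⟨hPQ.le.trans hAP.le, hPQ.free, Module.Free.of_equiv (LinearEquiv.ofBijective _ hs),
    Module.Finite.equiv (LinearEquiv.ofBijective _ hs)⟩

theorem Admissible.finrank_add [Nontrivial k] {A P Q : Submodule k V} (hAP : Admissible A P)
    (hPQ : Admissible P Q) : Module.finrank k (SubQuot A Q) =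
      Module.finrank k (SubQuot P Q) + Module.finrank k (SubQuot A P) := by
  obtain ⟨s, -, hs⟩ := exists_section_subQuot hPQ.le hAP
  have := hAP.free_quot
  have := hAP.finite_quot
  have := hPQ.free_quot
  have := hPQ.finite_quot
  exact finrank_of_coprod_bijective hs

theorem exists_admissible_le [Nontrivial k] {A N : Submodule k V} (hA : Module.Free k A)
    (hf : Module.Finite k (SubQuot A N)) : ∃ P ≤ N, Admissible A P := by
  obtain ⟨P, hPN, h1, h2, h3⟩ := exists_free_le_of_finite_quotient (N.submoduleOf A)
  have hP : (P.map A.subtype).submoduleOf A = P :=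
    Submodule.comap_map_eq_of_injective A.subtype_injective P
  refine ⟨P.map A.subtype, ?_, ?_, ?_, ?_, ?_⟩
  · rw [Submodule.map_le_iff_le_comap]
    exact hPN
  · exact Submodule.map_subtype_le A P
  · exact Module.Free.of_equiv (Submodule.equivMapOfInjective _ A.subtype_injective P)
  · exact Module.Free.of_equiv (Submodule.quotEquivOfEq _ _ hP).symm
  · exact Module.Finite.equiv (Submodule.quotEquivOfEq _ _ hP).symm

variable [IsLocalRing k] [IsArtinianRing k]

theorem Admissible.of_finite {A P : Submodule k V} (hPA : P ≤ A) (hA : Module.Free k A)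
    (hP : Module.Free k P) (hf : Module.Finite k (SubQuot A P)) : Admissible A P := by
  have hP : Module.Free k (P.submoduleOf A) :=
    Module.Free.of_equiv (Submodule.submoduleOfEquivOfLe hPA).symm
  exact ⟨hPA, ‹_›, free_quotient_of_free _, hf⟩

theorem Admissible.restrict {A P Q : Submodule k V} (hAP : Admissible A P) (hAQ : Admissible A Q)
    (hQP : Q ≤ P) : Admissible P Q := by
  have := hAQ.finite_quot
  exact .of_finite hQP hAP.free hAQ.free
    (Module.Finite.of_injective _ (subQuotMap_injective (P := Q) hAP.le))

theorem Admissible.exists_le_inf {A P Q : Submodule k V} (hP : Admissible A P)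
    (hQ : Admissible A Q) : ∃ R, R ≤ P ∧ R ≤ Q ∧ Admissible A R := by
  have := hP.finite_quot
  have := hQ.finite_quot
  have hinj : Function.Injective ((subQuotMap (le_refl A) (inf_le_left : P ⊓ Q ≤ P)).prod
      (subQuotMap (le_refl A) (inf_le_right : P ⊓ Q ≤ Q))) := by
    rw [injective_iff_map_eq_zero]
    intro x hx
    obtain ⟨x, rfl⟩ := Submodule.Quotient.mk_surjective _ x
    have h1 := congrArg Prod.fst hx
    have h2 := congrArg Prod.snd hx
    exact subQuot_mk_eq_zero.2 ⟨subQuot_mk_eq_zero.1 h1, subQuot_mk_eq_zero.1 h2⟩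
  obtain ⟨R, hR, h⟩ := exists_admissible_le hP.free_left (Module.Finite.of_injective _ hinj)
  exact ⟨R, hR.trans inf_le_left, hR.trans inf_le_right, h⟩

theorem Commensurable.exists_admissible {A B : Submodule k V} (hA : Module.Free k A)
    (hB : Module.Free k B) (h : Commensurable A B) : ∃ P, Admissible A P ∧ Admissible B P := by
  have : Module.Finite k (SubQuot (A ⊔ B) (A ⊓ B)) := h
  have hA' := Module.Finite.of_injective _
    (subQuotMap_injective (P := A ⊓ B) (le_sup_left : A ≤ A ⊔ B))
  have hB' := Module.Finite.of_injective _
    (subQuotMap_injective (P := A ⊓ B) (le_sup_right : B ≤ A ⊔ B))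
  obtain ⟨P, hP, hAP⟩ := exists_admissible_le hA hA'
  have := hAP.finite_quot
  have h1 := Module.Finite.of_injective _
    (subQuotMap_injective (P := P) (inf_le_left : A ⊓ B ≤ A))
  refine ⟨P, hAP, .of_finite (hP.trans inf_le_right) hB hAP.free ?_⟩
  exact Module.Finite.of_exact (subQuotMap_exact hP (inf_le_right : A ⊓ B ≤ B))
    (subQuotMap_surjective _)

end SubQuot

/-! ### The cancellation rule in terms of generators -/

section Cancellation

variable {k : Type*} [CommRing k] {V : Type*} [AddCommGroup V] [Module k V]

theorem map_subQuotMap_map {A B C P Q R : Submodule k V} (hAB : A ≤ B) (hBC : B ≤ C) (hPQ : P ≤ Q)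
    (hQR : Q ≤ R) (x : ExteriorAlgebra k (SubQuot A P)) :
    ExteriorAlgebra.map (subQuotMap hBC hQR) (ExteriorAlgebra.map (subQuotMap hAB hPQ) x) =
      ExteriorAlgebra.map (subQuotMap (hAB.trans hBC) (hPQ.trans hQR)) x := by
  rw [map_map]
  congr 2
  refine LinearMap.ext fun y => ?_
  obtain ⟨y, rfl⟩ := Submodule.Quotient.mk_surjective _ y
  rfl

/-- For `Q ≤ P ≤ A`: `p` and `a'` generate `det (P/Q)` and `det (A/P)`, `a` is a lifting of `a'` to
an exterior power of `A/Q`, and `pa = p ∧ a`. -/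
structure IsFrame {A P Q : Submodule k V} (hQP : Q ≤ P) (hPA : P ≤ A) (p : DetLine k (SubQuot P Q))
    (a : ⋀[k]^(Module.finrank k (SubQuot A P)) (SubQuot A Q)) (a' : DetLine k (SubQuot A P))
    (pa : DetLine k (SubQuot A Q)) : Prop where
  map_eq : (a' : ExteriorAlgebra k (SubQuot A P)) =
    ExteriorAlgebra.map (subQuotMap le_rfl hQP) (a : ExteriorAlgebra k (SubQuot A Q))
  wedge_eq : (pa : ExteriorAlgebra k (SubQuot A Q)) =
    ExteriorAlgebra.map (subQuotMap hPA (le_refl Q)) p * (a : ExteriorAlgebra k (SubQuot A Q))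
  gen_left : IsGenerator k p
  gen_right : IsGenerator k a'

variable [Nontrivial k]

/-- The product `p ∧ a`, for `p` in `det (P/Q)`, depends only on the image of `a` in the exterior
algebra of `A/P`. -/
theorem wedge_eq_wedge {A P Q : Submodule k V} (hAP : Admissible A P) (hPQ : Admissible P Q)
    (p : DetLine k (SubQuot P Q)) {a b : ExteriorAlgebra k (SubQuot A Q)}
    (h : ExteriorAlgebra.map (subQuotMap le_rfl hPQ.le) a =
      ExteriorAlgebra.map (subQuotMap (le_refl A) hPQ.le) b) :
    ExteriorAlgebra.map (subQuotMap hAP.le (le_refl Q)) p * a =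
      ExteriorAlgebra.map (subQuotMap hAP.le (le_refl Q)) p * b := by
  obtain ⟨s, hs, -⟩ := exists_section_subQuot hPQ.le hAP
  have := hPQ.free_quot
  have := hPQ.finite_quot
  refine mul_eq_mul_of_map_eq hs (fun y hy => ?_) h
  obtain ⟨y, rfl⟩ := (subQuotMap_exact hPQ.le hAP.le y).1 hy
  rw [← ExteriorAlgebra.map_apply_ι, ← map_mul, detLine_mul_ι_eq_zero, map_zero]

theorem wedge_mem {A P Q : Submodule k V} (hAP : Admissible A P) (hPQ : Admissible P Q)
    (p : DetLine k (SubQuot P Q))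
    (a : ⋀[k]^(Module.finrank k (SubQuot A P)) (SubQuot A Q)) :
    ExteriorAlgebra.map (subQuotMap hAP.le (le_refl Q)) p * (a : ExteriorAlgebra k (SubQuot A Q)) ∈
      ⋀[k]^(Module.finrank k (SubQuot A Q)) (SubQuot A Q) := by
  rw [hAP.finrank_add hPQ, ExteriorAlgebra.exteriorPower, pow_add]
  exact Submodule.mul_mem_mul (map_mem_exteriorPower _ p.2) a.2

theorem IsFrame.gen_wedge {A P Q : Submodule k V} (hAP : Admissible A P) (hPQ : Admissible P Q)
    {p : DetLine k (SubQuot P Q)} {a : ⋀[k]^(Module.finrank k (SubQuot A P)) (SubQuot A Q)}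
    {a' : DetLine k (SubQuot A P)} {pa : DetLine k (SubQuot A Q)}
    (h : IsFrame hPQ.le hAP.le p a a' pa) : IsGenerator k pa := by
  obtain ⟨s, hs, hs'⟩ := exists_section_subQuot hPQ.le hAP
  have := hPQ.free_quot
  have := hPQ.finite_quot
  have := hAP.free_quot
  have := hAP.finite_quot
  refine IsGenerator.mul hs' h.gen_left h.gen_right ?_
  rw [h.wedge_eq]
  refine wedge_eq_wedge hAP hPQ p ?_
  rw [map_map, hs, ExteriorAlgebra.map_id, AlgHom.id_apply, h.map_eq]

theorem exists_isFrame {A P Q : Submodule k V} (hAP : Admissible A P) (hPQ : Admissible P Q)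
    {p : DetLine k (SubQuot P Q)} (hp : IsGenerator k p) :
    ∃ a a' pa, IsFrame hPQ.le hAP.le p a a' pa := by
  obtain ⟨s, hs, -⟩ := exists_section_subQuot hPQ.le hAP
  have := hAP.free_quot
  have := hAP.finite_quot
  obtain ⟨a', ha'⟩ := exists_isGenerator_detLine k (SubQuot A P)
  refine ⟨⟨_, map_mem_exteriorPower s a'.2⟩, a', ⟨_, wedge_mem hAP hPQ p _⟩, ?_, rfl, hp, ha'⟩
  rw [map_map, hs, ExteriorAlgebra.map_id, AlgHom.id_apply]

theorem Admissible.exists_isGenerator {A P : Submodule k V} (h : Admissible A P) :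
    ∃ x : DetLine k (SubQuot A P), IsGenerator k x := by
  have := h.free_quot
  have := h.finite_quot
  exact exists_isGenerator_detLine k _

variable {A B P Q R : Submodule k V}

/-- With respect to frames that share the generator of `det (P/Q)`, the cancellation rule says that
the two isomorphisms have the same coordinate. -/
theorem cancels_iff (hAP : Admissible A P) (hBP : Admissible B P) (hPQ : Admissible P Q)
    {αQ : DetLine k (SubQuot A Q) ≃ₗ[k] DetLine k (SubQuot B Q)}
    {αP : DetLine k (SubQuot A P) ≃ₗ[k] DetLine k (SubQuot B P)}
    {p : DetLine k (SubQuot P Q)} {a : ⋀[k]^(Module.finrank k (SubQuot A P)) (SubQuot A Q)}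
    {a' : DetLine k (SubQuot A P)} {pa : DetLine k (SubQuot A Q)}
    (hA : IsFrame hPQ.le hAP.le p a a' pa)
    {b : ⋀[k]^(Module.finrank k (SubQuot B P)) (SubQuot B Q)}
    {b' : DetLine k (SubQuot B P)} {pb : DetLine k (SubQuot B Q)}
    (hB : IsFrame hPQ.le hBP.le p b b' pb) {u v : k} (hu : αP a' = u • b') (hv : αQ pa = v • pb) :
    Cancels hPQ.le hAP.le hBP.le αQ αP ↔ u = v := by
  constructor
  · intro h
    have h1 := h p a (u • b) a' (u • b') pa (u • pb) hA.map_eq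
      (by rw [Submodule.coe_smul, Submodule.coe_smul, map_smul, hB.map_eq]) hA.wedge_eq
      (by rw [Submodule.coe_smul, Submodule.coe_smul, mul_smul_comm, hB.wedge_eq]) hu
    exact (hB.gen_wedge hBP hPQ).smul_inj (h1.symm.trans hv)
  · rintro rfl q c d c' d' qc qd hc hd hqc hqd h
    obtain ⟨x, rfl⟩ := hA.gen_left.exists_smul q
    obtain ⟨y, rfl⟩ := hA.gen_right.exists_smul c'
    obtain ⟨z, rfl⟩ := hB.gen_right.exists_smul d'
    have hz : y * u = z := hB.gen_right.smul_inj (by rw [mul_smul, ← hu, ← map_smul, h])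
    have h1 : qc = (x * y) • pa := by
      refine Subtype.ext ?_
      rw [hqc, Submodule.coe_smul, Submodule.coe_smul, hA.wedge_eq, map_smul, smul_mul_assoc,
        mul_smul x, ← mul_smul_comm y]
      congr 1
      refine wedge_eq_wedge hAP hPQ p ?_
      rw [← hc, map_smul, ← hA.map_eq, Submodule.coe_smul]
    have h2 : qd = (x * z) • pb := by
      refine Subtype.ext ?_
      rw [hqd, Submodule.coe_smul, Submodule.coe_smul, hB.wedge_eq, map_smul, smul_mul_assoc,
        mul_smul x, ← mul_smul_comm z]
      congr 1
      refine wedge_eq_wedge hBP hPQ p ?_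
      rw [← hd, map_smul, ← hB.map_eq, Submodule.coe_smul]
    rw [h1, h2, map_smul, hv, smul_smul, ← hz, mul_assoc]

/-- The cancellation rule is surjective onto `Det(A, B; P)`. -/
theorem exists_cancels_of_le (hAP : Admissible A P) (hBP : Admissible B P) (hPQ : Admissible P Q)
    (αP : DetLine k (SubQuot A P) ≃ₗ[k] DetLine k (SubQuot B P)) :
    ∃ αQ, Cancels hPQ.le hAP.le hBP.le αQ αP := by
  obtain ⟨p, hp⟩ := hPQ.exists_isGenerator
  obtain ⟨a, a', pa, ha⟩ := exists_isFrame hAP hPQ hp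
  obtain ⟨b, b', pb, hb⟩ := exists_isFrame hBP hPQ hp
  obtain ⟨u, hu⟩ := hb.gen_right.exists_unit_smul (ha.gen_right.map αP)
  refine ⟨(ha.gen_wedge hAP hPQ).equiv ((hb.gen_wedge hBP hPQ).unit_smul u), ?_⟩
  exact (cancels_iff hAP hBP hPQ ha hb hu.symm (IsGenerator.equiv_apply _ _)).2 rfl

/-- The cancellation rule is defined on all of `Det(A, B; Q)`. -/
theorem exists_cancels_of_ge (hAP : Admissible A P) (hBP : Admissible B P) (hPQ : Admissible P Q)
    (αQ : DetLine k (SubQuot A Q) ≃ₗ[k] DetLine k (SubQuot B Q)) :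
    ∃ αP, Cancels hPQ.le hAP.le hBP.le αQ αP := by
  obtain ⟨p, hp⟩ := hPQ.exists_isGenerator
  obtain ⟨a, a', pa, ha⟩ := exists_isFrame hAP hPQ hp
  obtain ⟨b, b', pb, hb⟩ := exists_isFrame hBP hPQ hp
  obtain ⟨u, hu⟩ := (hb.gen_wedge hBP hPQ).exists_unit_smul ((ha.gen_wedge hAP hPQ).map αQ)
  refine ⟨ha.gen_right.equiv (hb.gen_right.unit_smul u), ?_⟩
  exact (cancels_iff hAP hBP hPQ ha hb (IsGenerator.equiv_apply _ _) hu.symm).2 rfl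

/-- The cancellation rule is injective. -/
theorem Cancels.eq_left (hAP : Admissible A P) (hBP : Admissible B P) (hPQ : Admissible P Q)
    {αQ αQ' : DetLine k (SubQuot A Q) ≃ₗ[k] DetLine k (SubQuot B Q)}
    {αP : DetLine k (SubQuot A P) ≃ₗ[k] DetLine k (SubQuot B P)}
    (h : Cancels hPQ.le hAP.le hBP.le αQ αP) (h' : Cancels hPQ.le hAP.le hBP.le αQ' αP) :
    αQ = αQ' := by
  obtain ⟨p, hp⟩ := hPQ.exists_isGenerator
  obtain ⟨a, a', pa, ha⟩ := exists_isFrame hAP hPQ hp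
  obtain ⟨b, b', pb, hb⟩ := exists_isFrame hBP hPQ hp
  obtain ⟨u, hu⟩ := hb.gen_right.exists_smul (αP a')
  obtain ⟨v, hv⟩ := (hb.gen_wedge hBP hPQ).exists_smul (αQ pa)
  obtain ⟨w, hw⟩ := (hb.gen_wedge hBP hPQ).exists_smul (αQ' pa)
  have h1 := (cancels_iff hAP hBP hPQ ha hb hu.symm hv.symm).1 h
  have h2 := (cancels_iff hAP hBP hPQ ha hb hu.symm hw.symm).1 h'
  exact (ha.gen_wedge hAP hPQ).equiv_ext (by rw [← hv, ← hw, ← h1, ← h2])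

/-- The cancellation rule is single-valued. -/
theorem Cancels.eq_right (hAP : Admissible A P) (hBP : Admissible B P) (hPQ : Admissible P Q)
    {αQ : DetLine k (SubQuot A Q) ≃ₗ[k] DetLine k (SubQuot B Q)}
    {αP αP' : DetLine k (SubQuot A P) ≃ₗ[k] DetLine k (SubQuot B P)}
    (h : Cancels hPQ.le hAP.le hBP.le αQ αP) (h' : Cancels hPQ.le hAP.le hBP.le αQ αP') :
    αP = αP' := by
  obtain ⟨p, hp⟩ := hPQ.exists_isGenerator
  obtain ⟨a, a', pa, ha⟩ := exists_isFrame hAP hPQ hp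
  obtain ⟨b, b', pb, hb⟩ := exists_isFrame hBP hPQ hp
  obtain ⟨u, hu⟩ := hb.gen_right.exists_smul (αP a')
  obtain ⟨w, hw⟩ := hb.gen_right.exists_smul (αP' a')
  obtain ⟨v, hv⟩ := (hb.gen_wedge hBP hPQ).exists_smul (αQ pa)
  have h1 := (cancels_iff hAP hBP hPQ ha hb hu.symm hv.symm).1 h
  have h2 := (cancels_iff hAP hBP hPQ ha hb hw.symm hv.symm).1 h'
  exact ha.gen_right.equiv_ext (by rw [← hu, ← hw, h1, h2])

/-- Frames for `Q ≤ P ≤ A`, `R ≤ Q ≤ A` and `R ≤ P ≤ A` that fit together: the top form of `A/R` is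
read as `r ∧ (p ∧ a)` and as `(r ∧ p) ∧ a`. -/
theorem exists_isFrame_tower (hAP : Admissible A P) (hPQ : Admissible P Q) (hQR : Admissible Q R)
    {r : DetLine k (SubQuot Q R)} {p : ⋀[k]^(Module.finrank k (SubQuot P Q)) (SubQuot P R)}
    {p' : DetLine k (SubQuot P Q)} {rp : DetLine k (SubQuot P R)}
    (hp : IsFrame hQR.le hPQ.le r p p' rp) :
    ∃ aR aQ a' pa pa' rpa, IsFrame (hQR.le.trans hPQ.le) hAP.le rp aR a' rpa ∧
      IsFrame hPQ.le hAP.le p' aQ a' pa ∧ IsFrame hQR.le (hPQ.le.trans hAP.le) r pa' pa rpa := by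
  obtain ⟨aR, a', rpa, hR⟩ := exists_isFrame hAP (hPQ.trans hQR) (hp.gen_wedge hPQ hQR)
  let aQ : ⋀[k]^(Module.finrank k (SubQuot A P)) (SubQuot A Q) :=
    ⟨_, map_mem_exteriorPower (subQuotMap (le_refl A) hQR.le) aR.2⟩
  let pa : DetLine k (SubQuot A Q) := ⟨_, wedge_mem hAP hPQ p' aQ⟩
  have hpa' : ExteriorAlgebra.map (subQuotMap hAP.le (le_refl R)) p *
      (aR : ExteriorAlgebra k (SubQuot A R)) ∈
        ⋀[k]^(Module.finrank k (SubQuot A Q)) (SubQuot A R) := by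
    rw [hAP.finrank_add hPQ, ExteriorAlgebra.exteriorPower, pow_add]
    exact Submodule.mul_mem_mul (map_mem_exteriorPower _ p.2) aR.2
  have hQ : IsFrame hPQ.le hAP.le p' aQ a' pa := by
    refine ⟨?_, rfl, hp.gen_right, hR.gen_right⟩
    rw [map_subQuotMap_map, hR.map_eq]
  refine ⟨aR, aQ, a', pa, ⟨_, hpa'⟩, rpa, hR, hQ, ?_, ?_, hp.gen_left, hQ.gen_wedge hAP hPQ⟩
  · rw [map_mul, hQ.wedge_eq, map_subQuotMap_map, hp.map_eq, map_subQuotMap_map]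
  · rw [hR.wedge_eq, hp.wedge_eq, map_mul, map_subQuotMap_map, mul_assoc]

/-- The transitivity of the cancellation rule, as a two-out-of-three principle. -/
theorem cancels_tower (hAP : Admissible A P) (hBP : Admissible B P) (hPQ : Admissible P Q)
    (hQR : Admissible Q R)
    (αP : DetLine k (SubQuot A P) ≃ₗ[k] DetLine k (SubQuot B P))
    (αQ : DetLine k (SubQuot A Q) ≃ₗ[k] DetLine k (SubQuot B Q))
    (αR : DetLine k (SubQuot A R) ≃ₗ[k] DetLine k (SubQuot B R)) :
    ∃ u v w : k, (Cancels hPQ.le hAP.le hBP.le αQ αP ↔ u = v) ∧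
      (Cancels hQR.le (hPQ.le.trans hAP.le) (hPQ.le.trans hBP.le) αR αQ ↔ v = w) ∧
      (Cancels (hQR.le.trans hPQ.le) hAP.le hBP.le αR αP ↔ u = w) := by
  obtain ⟨r, hr⟩ := hQR.exists_isGenerator
  obtain ⟨p, p', rp, hp⟩ := exists_isFrame hPQ hQR hr
  obtain ⟨aR, aQ, a', pa, pa', rpa, hA1, hA2, hA3⟩ := exists_isFrame_tower hAP hPQ hQR hp
  obtain ⟨bR, bQ, b', pb, pb', rpb, hB1, hB2, hB3⟩ := exists_isFrame_tower hBP hPQ hQR hp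
  obtain ⟨u, hu⟩ := hB1.gen_right.exists_smul (αP a')
  obtain ⟨v, hv⟩ := hB3.gen_right.exists_smul (αQ pa)
  obtain ⟨w, hw⟩ := (hB1.gen_wedge hBP (hPQ.trans hQR)).exists_smul (αR rpa)
  exact ⟨u, v, w, cancels_iff hAP hBP hPQ hA2 hB2 hu.symm hv.symm,
    cancels_iff (hAP.trans hPQ) (hBP.trans hPQ) hQR hA3 hB3 hv.symm hw.symm,
    cancels_iff hAP hBP (hPQ.trans hQR) hA1 hB1 hu.symm hw.symm⟩

theorem Cancels.trans (hAP : Admissible A P) (hBP : Admissible B P) (hPQ : Admissible P Q)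
    (hQR : Admissible Q R)
    {αP : DetLine k (SubQuot A P) ≃ₗ[k] DetLine k (SubQuot B P)}
    {αQ : DetLine k (SubQuot A Q) ≃ₗ[k] DetLine k (SubQuot B Q)}
    {αR : DetLine k (SubQuot A R) ≃ₗ[k] DetLine k (SubQuot B R)}
    (h1 : Cancels hQR.le (hPQ.le.trans hAP.le) (hPQ.le.trans hBP.le) αR αQ)
    (h2 : Cancels hPQ.le hAP.le hBP.le αQ αP) :
    Cancels (hQR.le.trans hPQ.le) hAP.le hBP.le αR αP := by
  obtain ⟨u, v, w, e1, e2, e3⟩ := cancels_tower hAP hBP hPQ hQR αP αQ αR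
  exact e3.2 ((e1.1 h2).trans (e2.1 h1))

theorem Cancels.of_trans (hAP : Admissible A P) (hBP : Admissible B P) (hPQ : Admissible P Q)
    (hQR : Admissible Q R)
    {αP : DetLine k (SubQuot A P) ≃ₗ[k] DetLine k (SubQuot B P)}
    {αQ : DetLine k (SubQuot A Q) ≃ₗ[k] DetLine k (SubQuot B Q)}
    {αR : DetLine k (SubQuot A R) ≃ₗ[k] DetLine k (SubQuot B R)}
    (h1 : Cancels hQR.le (hPQ.le.trans hAP.le) (hPQ.le.trans hBP.le) αR αQ)
    (h2 : Cancels (hQR.le.trans hPQ.le) hAP.le hBP.le αR αP) :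
    Cancels hPQ.le hAP.le hBP.le αQ αP := by
  obtain ⟨u, v, w, e1, e2, e3⟩ := cancels_tower hAP hBP hPQ hQR αP αQ αR
  exact e1.2 ((e3.1 h2).trans (e2.1 h1).symm)

/-- The cancellation rule is compatible with composition. -/
theorem Cancels.comp {C : Submodule k V} (hAP : Admissible A P) (hBP : Admissible B P)
    (hCP : Admissible C P) (hPQ : Admissible P Q)
    {αQ : DetLine k (SubQuot A Q) ≃ₗ[k] DetLine k (SubQuot B Q)}
    {αP : DetLine k (SubQuot A P) ≃ₗ[k] DetLine k (SubQuot B P)}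
    {βQ : DetLine k (SubQuot B Q) ≃ₗ[k] DetLine k (SubQuot C Q)}
    {βP : DetLine k (SubQuot B P) ≃ₗ[k] DetLine k (SubQuot C P)}
    (hα : Cancels hPQ.le hAP.le hBP.le αQ αP) (hβ : Cancels hPQ.le hBP.le hCP.le βQ βP) :
    Cancels hPQ.le hAP.le hCP.le (αQ.trans βQ) (αP.trans βP) := by
  obtain ⟨p, hp⟩ := hPQ.exists_isGenerator
  obtain ⟨a, a', pa, ha⟩ := exists_isFrame hAP hPQ hp
  obtain ⟨b, b', pb, hb⟩ := exists_isFrame hBP hPQ hp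
  obtain ⟨c, c', pc, hc⟩ := exists_isFrame hCP hPQ hp
  obtain ⟨u, hu⟩ := hb.gen_right.exists_smul (αP a')
  obtain ⟨v, hv⟩ := (hb.gen_wedge hBP hPQ).exists_smul (αQ pa)
  obtain ⟨w, hw⟩ := hc.gen_right.exists_smul (βP b')
  obtain ⟨x, hx⟩ := (hc.gen_wedge hCP hPQ).exists_smul (βQ pb)
  have h1 := (cancels_iff hAP hBP hPQ ha hb hu.symm hv.symm).1 hα
  have h2 := (cancels_iff hBP hCP hPQ hb hc hw.symm hx.symm).1 hβ
  refine (cancels_iff hAP hCP hPQ ha hc (u := u * w) (v := v * x) ?_ ?_).2 (by rw [h1, h2])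
  · rw [LinearEquiv.trans_apply, ← hu, map_smul, ← hw, smul_smul]
  · rw [LinearEquiv.trans_apply, ← hv, map_smul, ← hx, smul_smul]

end Cancellation

/-! ### The determinant groupoid -/

section Groupoid

variable {k : Type*} [CommRing k] {V : Type*} [AddCommGroup V] [Module k V]

theorem Admissible.map (σ : V ≃ₗ[k] V) {A A' P : Submodule k V}
    (hA : A.map (σ : V →ₗ[k] V) = A') (h : Admissible A P) :
    Admissible A' (P.map (σ : V →ₗ[k] V)) := by
  rw [Submodule.map_equiv_eq_comap_symm]
  refine h.comap σ.symm ?_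
  rw [← hA, ← Submodule.map_comp]
  simp

/-- `A` and `B` are linked if they have a common free submodule with free quotients of finite rank.
For free submodules this is commensurability. -/
def Linked (A B : Submodule k V) : Prop := ∃ P, Admissible A P ∧ Admissible B P

theorem Linked.symm {A B : Submodule k V} (h : Linked A B) : Linked B A :=
  let ⟨P, hA, hB⟩ := h
  ⟨P, hB, hA⟩

theorem Linked.map (σ : V ≃ₗ[k] V) {A B : Submodule k V} (h : Linked A B) :
    Linked (A.map (σ : V →ₗ[k] V)) (B.map (σ : V →ₗ[k] V)) :=
  let ⟨_, hA, hB⟩ := h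
  ⟨_, hA.map σ rfl, hB.map σ rfl⟩

variable [IsLocalRing k] [IsArtinianRing k] {A B C D : Submodule k V}

theorem Linked.exists_le (hAB : Linked A B) {P : Submodule k V} (hP : Admissible A P) :
    ∃ Q ≤ P, Admissible A Q ∧ Admissible B Q := by
  obtain ⟨R, hA, hB⟩ := hAB
  obtain ⟨Q, hQR, hQP, hQ⟩ := hA.exists_le_inf hP
  exact ⟨Q, hQP, hQ, hB.trans (hA.restrict hQ hQR)⟩

theorem Linked.exists_admissible₃ (hAB : Linked A B) (hAC : Linked A C) :
    ∃ P, Admissible A P ∧ Admissible B P ∧ Admissible C P := by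
  obtain ⟨Q, hA, hB⟩ := hAB
  obtain ⟨P, hPQ, hA', hC⟩ := hAC.exists_le hA
  exact ⟨P, hA', hB.trans (hA.restrict hA' hPQ), hC⟩

theorem Linked.exists_admissible₄ (hAB : Linked A B) (hAC : Linked A C) (hAD : Linked A D) :
    ∃ P, Admissible A P ∧ Admissible B P ∧ Admissible C P ∧ Admissible D P := by
  obtain ⟨Q, hA, hB, hC⟩ := hAB.exists_admissible₃ hAC
  obtain ⟨P, hPQ, hA', hD⟩ := hAD.exists_le hA
  exact ⟨P, hA', hB.trans (hA.restrict hA' hPQ), hC.trans (hA.restrict hA' hPQ), hD⟩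

theorem Linked.trans (hAB : Linked A B) (hBC : Linked B C) : Linked A C :=
  let ⟨P, _, hA, hC⟩ := hAB.symm.exists_admissible₃ hBC
  ⟨P, hA, hC⟩

/-- An isomorphism at one level `P` extends to an element of the inverse limit. -/
theorem DetHom.exists_app_eq {P : Submodule k V} (hA : Admissible A P) (hB : Admissible B P)
    (α₀ : DetLine k (SubQuot A P) ≃ₗ[k] DetLine k (SubQuot B P)) :
    ∃ α : DetHom A B, α.app P hA hB = α₀ := by
  -- At a level `P'`, lift `α₀` to some `R` below `P` and `P'` and descend to `P'`.
  have hex : ∀ P' (hA' : Admissible A P') (hB' : Admissible B P'),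
      ∃ α' : DetLine k (SubQuot A P') ≃ₗ[k] DetLine k (SubQuot B P'), ∃ R,
        ∃ (hR : Admissible P R) (hR' : Admissible P' R), ∃ αR,
          Cancels hR.le hA.le hB.le αR α₀ ∧ Cancels hR'.le hA'.le hB'.le αR α' := by
    intro P' hA' hB'
    obtain ⟨R, hRP, hRP', hR⟩ := hA.exists_le_inf hA'
    obtain ⟨αR, h1⟩ := exists_cancels_of_le hA hB (hA.restrict hR hRP) α₀
    obtain ⟨α', h2⟩ := exists_cancels_of_ge hA' hB' (hA'.restrict hR hRP') αR
    exact ⟨α', R, hA.restrict hR hRP, hA'.restrict hR hRP', αR, h1, h2⟩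
  choose f hf using hex
  refine ⟨⟨f, fun P' Q' hAP hBP hAQ hBQ hQP => ?_⟩, ?_⟩
  · obtain ⟨R₁, hR₁, hR₁', α₁, h1, h1'⟩ := hf P' hAP hBP
    obtain ⟨R₂, hR₂, hR₂', α₂, h2, h2'⟩ := hf Q' hAQ hBQ
    obtain ⟨R, hRR₁, hRR₂, hR⟩ := (hA.trans hR₁).exists_le_inf (hA.trans hR₂)
    have k1 := (hA.trans hR₁).restrict hR hRR₁
    have k2 := (hA.trans hR₂).restrict hR hRR₂
    obtain ⟨β, hβ⟩ := exists_cancels_of_le (hA.trans hR₁) (hB.trans hR₁) k1 α₁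
    obtain ⟨β', hβ'⟩ := exists_cancels_of_le (hA.trans hR₂) (hB.trans hR₂) k2 α₂
    obtain rfl : β = β' := Cancels.eq_left hA hB (hR₁.trans k1)
      (hβ.trans hA hB hR₁ k1 h1) (hβ'.trans hA hB hR₂ k2 h2)
    exact Cancels.of_trans hAP hBP (hAP.restrict hAQ hQP) (hR₂'.trans k2)
      (hβ'.trans hAQ hBQ hR₂' k2 h2') (hβ.trans hAP hBP hR₁' k1 h1')
  · obtain ⟨R, hR, hR', αR, h1, h2⟩ := hf P hA hB
    exact Cancels.eq_right hA hB hR h2 h1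

/-- `Det(A, B)` is nonempty. When `A` and `B` have no common level, the inverse limit is over the
empty family and has exactly one element. -/
instance DetHom.instNonempty : Nonempty (DetHom A B) := by
  by_cases h : ∃ P, Admissible A P ∧ Admissible B P
  · obtain ⟨P, hA, hB⟩ := h
    obtain ⟨x, hx⟩ := hA.exists_isGenerator
    obtain ⟨y, hy⟩ := hB.exists_isGenerator
    exact ⟨(DetHom.exists_app_eq hA hB (hx.equiv hy)).choose⟩
  · exact ⟨⟨fun P hA hB => (h ⟨P, hA, hB⟩).elim, fun P _ hA hB => (h ⟨P, hA, hB⟩).elim⟩⟩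

omit [IsArtinianRing k] in
/-- Two compatible families that agree at one level agree at every level. -/
theorem eq_of_cancels {P P' R : Submodule k V} (hA : Admissible A P) (hB : Admissible B P)
    (hA' : Admissible A P') (hB' : Admissible B P') (hR : Admissible P R) (hR' : Admissible P' R)
    {αP : DetLine k (SubQuot A P) ≃ₗ[k] DetLine k (SubQuot B P)}
    {αP' βP' : DetLine k (SubQuot A P') ≃ₗ[k] DetLine k (SubQuot B P')}
    {αR βR : DetLine k (SubQuot A R) ≃ₗ[k] DetLine k (SubQuot B R)}
    (h1 : Cancels hR.le hA.le hB.le αR αP) (h2 : Cancels hR.le hA.le hB.le βR αP)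
    (h1' : Cancels hR'.le hA'.le hB'.le αR αP') (h2' : Cancels hR'.le hA'.le hB'.le βR βP') :
    αP' = βP' := by
  obtain rfl : αR = βR := Cancels.eq_left hA hB hR h1 h2
  exact Cancels.eq_right hA' hB' hR' h1' h2'

theorem DetHom.eq_of_app_eq {P : Submodule k V} (hA : Admissible A P) (hB : Admissible B P)
    {α β : DetHom A B} (h : α.app P hA hB = β.app P hA hB) : α = β := by
  refine DetHom.ext (funext fun P' => funext fun hA' => funext fun hB' => ?_)
  obtain ⟨R, hRP, hRP', hR⟩ := hA.exists_le_inf hA'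
  have k1 := hA.restrict hR hRP
  have k2 := hA'.restrict hR hRP'
  exact eq_of_cancels hA hB hA' hB' k1 k2 (α.cancels P R hA hB hR (hB.trans k1) hRP)
    (h ▸ β.cancels P R hA hB hR (hB.trans k1) hRP)
    (α.cancels P' R hA' hB' hR (hB.trans k1) hRP') (β.cancels P' R hA' hB' hR (hB.trans k1) hRP')

theorem IsComp.of_app {α : DetHom A B} {β : DetHom B C} {γ : DetHom A C} {P : Submodule k V}
    (hA : Admissible A P) (hB : Admissible B P) (hC : Admissible C P)
    (h : γ.app P hA hC = (α.app P hA hB).trans (β.app P hB hC)) : IsComp α β γ := by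
  intro P' hA' hB' hC' x
  obtain ⟨R, hRP, hRP', hR⟩ := hA.exists_le_inf hA'
  have k1 := hA.restrict hR hRP
  have k2 := hA'.restrict hR hRP'
  have hBR := hB.trans k1
  have hCR := hC.trans k1
  have h1 := Cancels.comp hA hB hC k1 (α.cancels P R hA hB hR hBR hRP)
    (β.cancels P R hB hC hBR hCR hRP)
  have h2 := Cancels.comp hA' hB' hC' k2 (α.cancels P' R hA' hB' hR hBR hRP')
    (β.cancels P' R hB' hC' hBR hCR hRP')
  exact LinearEquiv.congr_fun (eq_of_cancels hA hC hA' hC' k1 k2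
    (γ.cancels P R hA hC hR hCR hRP) (h ▸ h1) (γ.cancels P' R hA' hC' hR hCR hRP') h2) x

theorem exists_isComp (α : DetHom A B) (β : DetHom B C) : ∃ γ, IsComp α β γ := by
  by_cases h : ∃ P, Admissible A P ∧ Admissible B P ∧ Admissible C P
  · obtain ⟨P, hA, hB, hC⟩ := h
    obtain ⟨γ, hγ⟩ := DetHom.exists_app_eq hA hC ((α.app P hA hB).trans (β.app P hB hC))
    exact ⟨γ, .of_app hA hB hC hγ⟩
  · exact ⟨Classical.arbitrary _, fun P hA hB hC => (h ⟨P, hA, hB, hC⟩).elim⟩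

/-- The composition of `Det(A, B)` and `Det(B, C)`. It is determined by its arguments as soon as
`A`, `B` and `C` are linked. -/
def DetHom.trans (α : DetHom A B) (β : DetHom B C) : DetHom A C := (exists_isComp α β).choose

theorem DetHom.isComp_trans (α : DetHom A B) (β : DetHom B C) : IsComp α β (α.trans β) :=
  (exists_isComp α β).choose_spec

theorem DetHom.trans_app (α : DetHom A B) (β : DetHom B C) {P : Submodule k V}
    (hA : Admissible A P) (hB : Admissible B P) (hC : Admissible C P) :
    (α.trans β).app P hA hC = (α.app P hA hB).trans (β.app P hB hC) :=
  LinearEquiv.ext (α.isComp_trans β P hA hB hC)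

theorem isComp_iff (hAB : Linked A B) (hAC : Linked A C) {α : DetHom A B} {β : DetHom B C}
    {γ : DetHom A C} : IsComp α β γ ↔ γ = α.trans β := by
  obtain ⟨P, hA, hB, hC⟩ := hAB.exists_admissible₃ hAC
  refine ⟨fun h => DetHom.eq_of_app_eq hA hC ?_, fun h => h ▸ α.isComp_trans β⟩
  rw [DetHom.trans_app α β hA hB hC]
  exact LinearEquiv.ext (h P hA hB hC)

theorem DetHom.trans_assoc (hAB : Linked A B) (hAC : Linked A C) (hAD : Linked A D)
    (α : DetHom A B) (β : DetHom B C) (γ : DetHom C D) :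
    (α.trans β).trans γ = α.trans (β.trans γ) := by
  obtain ⟨P, hA, hB, hC, hD⟩ := hAB.exists_admissible₄ hAC hAD
  refine DetHom.eq_of_app_eq hA hD ?_
  rw [trans_app _ _ hA hC hD, trans_app _ _ hA hB hC, trans_app _ _ hA hB hD,
    trans_app _ _ hB hC hD]
  rfl

theorem DetHom.trans_smul (hAB : Linked A B) (hAC : Linked A C) (α : DetHom A B) (β : DetHom B C)
    (c : kˣ) : α.trans (β.smul c) = (α.trans β).smul c :=
  ((isComp_iff hAB hAC).1 ((α.isComp_trans β).smul_right c)).symm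

theorem DetHom.smul_trans (hAB : Linked A B) (hAC : Linked A C) (α : DetHom A B) (β : DetHom B C)
    (c : kˣ) : (α.smul c).trans β = (α.trans β).smul c :=
  ((isComp_iff hAB hAC).1 ((α.isComp_trans β).smul_left c)).symm

theorem DetHom.trans_left_cancel (hAB : Linked A B) (hAC : Linked A C) {α : DetHom A B}
    {β β' : DetHom B C} (h : α.trans β = α.trans β') : β = β' := by
  obtain ⟨P, hA, hB, hC⟩ := hAB.exists_admissible₃ hAC
  refine DetHom.eq_of_app_eq hB hC (LinearEquiv.ext fun x => ?_)
  obtain ⟨y, rfl⟩ := (α.app P hA hB).surjective x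
  rw [← LinearEquiv.trans_apply, ← LinearEquiv.trans_apply, ← trans_app α β hA hB hC, h,
    trans_app α β' hA hB hC]

omit [IsLocalRing k] [IsArtinianRing k] in
theorem DetHom.smul_smul (c d : kˣ) (α : DetHom A B) : (α.smul c).smul d = α.smul (d * c) :=
  DetHom.ext (funext fun P => funext fun hA => funext fun hB => LinearEquiv.ext fun x =>
    (mul_smul d c (α.app P hA hB x)).symm)

/-- `Det(A, B)` is a torsor under `kˣ`: transitivity. -/
theorem DetHom.exists_smul_eq (hAB : Linked A B) (α β : DetHom A B) : ∃ c : kˣ, α.smul c = β := by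
  obtain ⟨P, hA, hB⟩ := hAB
  obtain ⟨x, hx⟩ := hA.exists_isGenerator
  obtain ⟨c, hc⟩ := (hx.map (α.app P hA hB)).exists_unit_smul (hx.map (β.app P hA hB))
  exact ⟨c, DetHom.eq_of_app_eq hA hB (hx.equiv_ext hc)⟩

omit [IsArtinianRing k] in
/-- `Det(A, B)` is a torsor under `kˣ`: freeness. -/
theorem DetHom.smul_inj (hAB : Linked A B) {α : DetHom A B} {c d : kˣ}
    (h : α.smul c = α.smul d) : c = d := by
  obtain ⟨P, hA, hB⟩ := hAB
  obtain ⟨x, hx⟩ := hA.exists_isGenerator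
  have h1 : c • α.app P hA hB x = d • α.app P hA hB x :=
    congrArg (fun γ : DetHom A B => γ.app P hA hB x) h
  exact Units.ext ((hx.map (α.app P hA hB)).smul_inj h1)

section Push

variable (σ : V ≃ₗ[k] V) {A' B' C' : Submodule k V} (hA : A.map (σ : V →ₗ[k] V) = A')
  (hB : B.map (σ : V →ₗ[k] V) = B') (hC : C.map (σ : V →ₗ[k] V) = C')

omit [IsLocalRing k] [IsArtinianRing k] in
theorem DetHom.push_smul (α : DetHom A B) (c : kˣ) :
    (α.smul c).push σ hA hB = (α.push σ hA hB).smul c := by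
  refine DetHom.ext (funext fun P => funext fun hAP => funext fun hBP => LinearEquiv.ext fun x => ?_)
  have h : ∀ z, detEquiv (subQuotEquiv σ hB P) (c • z) = c • detEquiv (subQuotEquiv σ hB P) z :=
    fun z => map_smul _ (c : k) z
  exact h (α.app _ (hAP.comap σ hA) (hBP.comap σ hB) _)

theorem DetHom.push_trans (hAB : Linked A B) (hAC : Linked A C) (α : DetHom A B) (β : DetHom B C) :
    (α.trans β).push σ hA hC = (α.push σ hA hB).trans (β.push σ hB hC) := by
  subst hA hB hC
  refine (isComp_iff (hAB.map σ) (hAC.map σ)).1 fun P hA hB hC x => ?_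
  have h := α.isComp_trans β _ (hA.comap σ rfl) (hB.comap σ rfl) (hC.comap σ rfl)
    ((detEquiv (subQuotEquiv σ rfl P)).symm x)
  refine (congrArg (detEquiv (subQuotEquiv σ rfl P)) h).trans ?_
  refine congrArg (fun y => detEquiv (subQuotEquiv σ rfl P) (β.app _ _ _ y)) ?_
  exact ((detEquiv (subQuotEquiv σ rfl P)).symm_apply_apply _).symm

omit [IsLocalRing k] [IsArtinianRing k] in
theorem detEquiv_subQuotEquiv_mul (τ : V ≃ₗ[k] V) {A'' : Submodule k V}
    (hA' : A'.map (τ : V →ₗ[k] V) = A'')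
    (hA'' : A.map ((τ * σ : V ≃ₗ[k] V) : V →ₗ[k] V) = A'') (P : Submodule k V)
    (y : DetLine k (SubQuot A (P.comap ((τ * σ : V ≃ₗ[k] V) : V →ₗ[k] V)))) :
    detEquiv (subQuotEquiv (τ * σ) hA'' P) y =
      detEquiv (subQuotEquiv τ hA' P)
        (detEquiv (subQuotEquiv σ hA (P.comap (τ : V →ₗ[k] V))) y) := by
  refine Subtype.ext ?_
  refine Eq.trans ?_ (map_map (subQuotEquiv σ hA (P.comap (τ : V →ₗ[k] V))).toLinearMap
    (subQuotEquiv τ hA' P).toLinearMap y.1).symm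
  refine congrArg (fun f => ExteriorAlgebra.map f y.1) (LinearMap.ext fun z => ?_)
  obtain ⟨z, rfl⟩ := Submodule.Quotient.mk_surjective _ z
  rfl

omit [IsLocalRing k] [IsArtinianRing k] in
/-- The functors `σ_*` compose; the level `P` is pulled back along `τ` and `σ` or along `τ σ`, which
is the same submodule definitionally. -/
theorem DetHom.push_push (τ : V ≃ₗ[k] V) {A'' B'' : Submodule k V}
    (hA' : A'.map (τ : V →ₗ[k] V) = A'') (hB' : B'.map (τ : V →ₗ[k] V) = B'')
    (hA'' : A.map ((τ * σ : V ≃ₗ[k] V) : V →ₗ[k] V) = A'')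
    (hB'' : B.map ((τ * σ : V ≃ₗ[k] V) : V →ₗ[k] V) = B'') (α : DetHom A B) :
    (α.push σ hA hB).push τ hA' hB' = α.push (τ * σ) hA'' hB'' := by
  refine DetHom.ext (funext fun P => funext fun hAP => funext fun hBP => LinearEquiv.ext fun x => ?_)
  obtain ⟨y, rfl⟩ := (detEquiv (subQuotEquiv (τ * σ) hA'' P)).surjective x
  have h1 := detEquiv_subQuotEquiv_mul σ hA τ hA' hA'' P y
  have h2 : (detEquiv (subQuotEquiv σ hA (P.comap (τ : V →ₗ[k] V)))).symm
      ((detEquiv (subQuotEquiv τ hA' P)).symm (detEquiv (subQuotEquiv (τ * σ) hA'' P) y)) = y := by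
    rw [h1, LinearEquiv.symm_apply_apply]
    exact LinearEquiv.symm_apply_apply (detEquiv (subQuotEquiv σ hA (P.comap (τ : V →ₗ[k] V)))) y
  have h3 := LinearEquiv.symm_apply_apply (detEquiv (subQuotEquiv (τ * σ) hA'' P)) y
  refine Eq.trans (congrArg (fun w => detEquiv (subQuotEquiv τ hB' P)
    (detEquiv (subQuotEquiv σ hB (P.comap (τ : V →ₗ[k] V))) (α.app _ _ _ w))) h2) ?_
  refine Eq.trans ?_ (congrArg (fun w => detEquiv (subQuotEquiv (τ * σ) hB'' P)
    (α.app _ (hAP.comap (τ * σ) hA'') (hBP.comap (τ * σ) hB'') w)) h3).symm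
  exact (detEquiv_subQuotEquiv_mul σ hB τ hB' hB'' P _).symm

end Push

end Groupoid

/-! ### The central extension and its commutators -/

section Symbol

variable {k : Type*} [CommRing k] {V : Type*} [AddCommGroup V] [Module k V]

theorem Linked.commensurable {A B : Submodule k V} (h : Linked A B) : Commensurable A B := by
  obtain ⟨P, hA, hB⟩ := h
  have := hA.finite_quot
  have := hB.finite_quot
  have hP : P ≤ A ⊓ B := le_inf hA.le hB.le
  refine Module.Finite.of_surjective ((subQuotMap (le_sup_left : A ≤ A ⊔ B) hP).coprod
    (subQuotMap (le_sup_right : B ≤ A ⊔ B) hP)) fun x => ?_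
  obtain ⟨⟨x, hx⟩, rfl⟩ := Submodule.Quotient.mk_surjective _ x
  obtain ⟨a, ha, b, hb, rfl⟩ := Submodule.mem_sup.1 hx
  exact ⟨(Submodule.Quotient.mk ⟨a, ha⟩, Submodule.Quotient.mk ⟨b, hb⟩), rfl⟩

variable [IsLocalRing k] [IsArtinianRing k] {Vp : Submodule k V}

theorem linked_of_isObj (hVp : Module.Free k Vp) {A : Submodule k V} (hA : IsObj Vp A) :
    Linked Vp A :=
  let ⟨P, h1, h2⟩ := hA.comm.exists_admissible hA.free hVp
  ⟨P, h2, h1⟩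

theorem linked_of_mem_restrictedGL (hVp : Module.Free k Vp) {σ : V ≃ₗ[k] V}
    (hσ : σ ∈ restrictedGL Vp) : Linked Vp (Vp.map (σ : V →ₗ[k] V)) :=
  Commensurable.exists_admissible hVp (Module.Free.of_equiv (σ.submoduleMap Vp)) hσ

theorem linked_map_of_isObj (hVp : Module.Free k Vp) {σ : V ≃ₗ[k] V}
    (hσ : σ ∈ restrictedGL Vp) {A : Submodule k V} (hA : IsObj Vp A) :
    Linked Vp (A.map (σ : V →ₗ[k] V)) :=
  (linked_of_mem_restrictedGL hVp hσ).trans ((linked_of_isObj hVp hA).map σ)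

omit [IsArtinianRing k] in
theorem linked_self (hVp : Module.Free k Vp) : Linked Vp Vp := by
  have : Subsingleton (SubQuot Vp Vp) :=
    Submodule.Quotient.subsingleton_iff.2 (Submodule.submoduleOf_self Vp)
  obtain ⟨P, -, hP⟩ := exists_admissible_le (N := Vp) hVp inferInstance
  exact ⟨P, hP, hP⟩

omit [IsArtinianRing k] in
theorem isObj_self (hVp : Module.Free k Vp) : IsObj Vp Vp :=
  ⟨hVp, (linked_self hVp).commensurable⟩

theorem mul_mem_restrictedGL (hVp : Module.Free k Vp) {σ τ : V ≃ₗ[k] V}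
    (hσ : σ ∈ restrictedGL Vp) (hτ : τ ∈ restrictedGL Vp) : σ * τ ∈ restrictedGL Vp := by
  have h := (linked_of_mem_restrictedGL hVp hσ).trans
    ((linked_of_mem_restrictedGL hVp hτ).map σ)
  rw [← Submodule.map_comp] at h
  exact h.commensurable

/-- Every element of the restricted general linear group lifts to the central extension: choose
`φ₀` in `Det(V₊, σ V₊)` and, for each object `A`, some `α A` in `Det(V₊, A)`, and take for `Φ A` the
element with `Φ A ∘ α A = σ_* (α A) ∘ φ₀`. -/
theorem exists_lift (hVp : Module.Free k Vp) {σ : V ≃ₗ[k] V} (hσ : σ ∈ restrictedGL Vp) :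
    ∃ s : CentralExt Vp, s.σ = σ := by
  obtain ⟨φ₀⟩ : Nonempty (DetHom Vp (Vp.map (σ : V →ₗ[k] V))) := inferInstance
  let a : ∀ A, DetHom Vp A := fun A => Classical.arbitrary _
  have hL := fun {A} (hA : IsObj Vp A) => linked_of_isObj hVp hA
  have hM := fun {A} (hA : IsObj Vp A) => linked_map_of_isObj hVp hσ hA
  have hS := linked_of_mem_restrictedGL hVp hσ
  have hex : ∀ A, IsObj Vp A → ∃ φ : DetHom A (A.map (σ : V →ₗ[k] V)),
      (a A).trans φ = φ₀.trans ((a A).push σ rfl rfl) := by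
    intro A hA
    obtain ⟨ψ⟩ : Nonempty (DetHom A (A.map (σ : V →ₗ[k] V))) := inferInstance
    obtain ⟨c, hc⟩ := DetHom.exists_smul_eq (hM hA) ((a A).trans ψ)
      (φ₀.trans ((a A).push σ rfl rfl))
    exact ⟨ψ.smul c, by rw [DetHom.trans_smul (hL hA) (hM hA), hc]⟩
  choose Φ hΦ using hex
  refine ⟨⟨σ, hσ, Φ, fun A B hA hB α γ => ?_⟩, rfl⟩
  rw [isComp_iff ((hL hA).symm.trans (hL hB)) ((hL hA).symm.trans (hM hB)),
    isComp_iff ((hL hA).symm.trans (hM hA)) ((hL hA).symm.trans (hM hB))]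
  suffices h : α.trans (Φ B hB) = (Φ A hA).trans (α.push σ rfl rfl) by rw [h]
  obtain ⟨n, hn⟩ := DetHom.exists_smul_eq (hL hB) (a B) ((a A).trans α)
  refine DetHom.trans_left_cancel (hL hA) (hM hB) (α := a A) ?_
  rw [← DetHom.trans_assoc (hL hA) (hL hB) (hM hB), ← hn, DetHom.smul_trans (hL hB) (hM hB), hΦ,
    ← DetHom.trans_assoc (hL hA) (hM hA) (hM hB), hΦ, DetHom.trans_assoc hS (hM hA) (hM hB),
    ← DetHom.push_trans σ rfl rfl rfl (hL hA) (hL hB), ← hn, DetHom.push_smul,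
    DetHom.trans_smul hS (hM hB)]

theorem CentralExt.trans_Φ (hVp : Module.Free k Vp) (s : CentralExt Vp) {A B : Submodule k V}
    (hA : IsObj Vp A) (hB : IsObj Vp B) (α : DetHom A B) :
    α.trans (s.Φ B hB) = (s.Φ A hA).trans (α.push s.σ rfl rfl) := by
  have hLA := (linked_of_isObj hVp hA).symm
  refine (isComp_iff (hLA.trans (linked_map_of_isObj hVp s.mem hA))
    (hLA.trans (linked_map_of_isObj hVp s.mem hB))).1 ?_
  exact (s.natural A B hA hB α _).1 (α.isComp_trans _)

/-- The product in the central extension. Its underlying automorphism is passed as an argument, so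
that the two products of lifts of commuting automorphisms lie over the same automorphism
definitionally. -/
def CentralExt.mul (hVp : Module.Free k Vp) (s t : CentralExt Vp) (ρ : V ≃ₗ[k] V)
    (hρ : ρ = s.σ * t.σ) : CentralExt Vp where
  σ := ρ
  mem := hρ ▸ mul_mem_restrictedGL hVp s.mem t.mem
  Φ A hA := (s.Φ A hA).trans
    ((t.Φ A hA).push s.σ rfl (by rw [hρ, ← Submodule.map_comp]; rfl))
  natural A B hA hB α γ := by
    subst hρ
    have hm := mul_mem_restrictedGL hVp s.mem t.mem
    have hLA := (linked_of_isObj hVp hA).symm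
    have hAB := hLA.trans (linked_of_isObj hVp hB)
    have hAs := hLA.trans (linked_map_of_isObj hVp s.mem hA)
    have hBs := hLA.trans (linked_map_of_isObj hVp s.mem hB)
    have hAt := hLA.trans (linked_map_of_isObj hVp t.mem hA)
    have hBt := hLA.trans (linked_map_of_isObj hVp t.mem hB)
    have hAm := hLA.trans (linked_map_of_isObj hVp hm hA)
    have hBm := hLA.trans (linked_map_of_isObj hVp hm hB)
    rw [isComp_iff hAB hBm, isComp_iff hAm hBm]
    suffices h : ∀ {X Y : Submodule k V} (hX : (A.map (t.σ : V →ₗ[k] V)).map (s.σ : V →ₗ[k] V) = X)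
        (hY : (B.map (t.σ : V →ₗ[k] V)).map (s.σ : V →ₗ[k] V) = Y)
        (hX' : A.map ((s.σ * t.σ : V ≃ₗ[k] V) : V →ₗ[k] V) = X)
        (hY' : B.map ((s.σ * t.σ : V ≃ₗ[k] V) : V →ₗ[k] V) = Y),
        α.trans ((s.Φ B hB).trans ((t.Φ B hB).push s.σ rfl hY)) =
          ((s.Φ A hA).trans ((t.Φ A hA).push s.σ rfl hX)).trans (α.push (s.σ * t.σ) hX' hY') by
      rw [h]
    intro X Y hX hY hX' hY'
    replace hAm : Linked A X := hX' ▸ hAm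
    replace hBm : Linked A Y := hY' ▸ hBm
    rw [← DetHom.trans_assoc hAB hBs hBm, s.trans_Φ hVp hA hB,
      DetHom.trans_assoc hAs hBs hBm, ← DetHom.push_trans s.σ rfl rfl hY hAB hBt,
      t.trans_Φ hVp hA hB, DetHom.push_trans s.σ rfl hX hY hAt hBt,
      DetHom.push_push t.σ rfl rfl s.σ hX hY hX' hY', DetHom.trans_assoc hAs hAm hBm]

/-- The commutator of liftings of `σ` and `τ` is `c`, expressed at the object `V₊` through arbitrary elements
of `Det(V₊, σ V₊)` and `Det(V₊, τ V₊)`: `σ_* β ∘ α = c · (τ_* α ∘ β)`. The common target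
`σ τ V₊ = τ σ V₊` is a variable `T`, because the two sides are equal only propositionally. -/
def IsRatio (Vp : Submodule k V) (σ τ : V ≃ₗ[k] V) (c : kˣ) : Prop :=
  ∀ (T : Submodule k V) (h₁ : (Vp.map (τ : V →ₗ[k] V)).map (σ : V →ₗ[k] V) = T)
    (h₂ : (Vp.map (σ : V →ₗ[k] V)).map (τ : V →ₗ[k] V) = T)
    (α : DetHom Vp (Vp.map (σ : V →ₗ[k] V))) (β : DetHom Vp (Vp.map (τ : V →ₗ[k] V))),
    α.trans (β.push σ rfl h₁) = (β.trans (α.push τ rfl h₂)).smul c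

variable {σ τ : V ≃ₗ[k] V}

theorem exists_isRatio (hVp : Module.Free k Vp) (hσ : σ ∈ restrictedGL Vp)
    (hτ : τ ∈ restrictedGL Vp) : ∃ c, IsRatio Vp σ τ c := by
  by_cases hT : (Vp.map (τ : V →ₗ[k] V)).map (σ : V →ₗ[k] V) =
    (Vp.map (σ : V →ₗ[k] V)).map (τ : V →ₗ[k] V)
  swap
  -- Without a common target the condition is vacuous.
  · exact ⟨1, fun T h₁ h₂ => (hT (h₁.trans h₂.symm)).elim⟩
  have hS := linked_of_mem_restrictedGL hVp hσ
  have hS' := linked_of_mem_restrictedGL hVp hτ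
  have hL := hS.trans (hS'.map σ)
  obtain ⟨α₀⟩ : Nonempty (DetHom Vp (Vp.map (σ : V →ₗ[k] V))) := inferInstance
  obtain ⟨β₀⟩ : Nonempty (DetHom Vp (Vp.map (τ : V →ₗ[k] V))) := inferInstance
  obtain ⟨c, hc⟩ := DetHom.exists_smul_eq hL (β₀.trans (α₀.push τ rfl hT.symm))
    (α₀.trans (β₀.push σ rfl rfl))
  refine ⟨c, fun T h₁ h₂ α β => ?_⟩
  subst h₁
  obtain ⟨x, rfl⟩ := DetHom.exists_smul_eq hS α₀ α
  obtain ⟨y, rfl⟩ := DetHom.exists_smul_eq hS' β₀ β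
  rw [DetHom.push_smul, DetHom.push_smul, DetHom.trans_smul hS hL, DetHom.smul_trans hS hL,
    DetHom.trans_smul hS' hL, DetHom.smul_trans hS' hL, ← hc]
  simp only [DetHom.smul_smul]
  congr 1
  rw [← mul_assoc, mul_comm, mul_comm y x]

/-- Both products lie over the same automorphism, so by naturality they are compared at `V₊`. -/
theorem IsRatio.isCommutator (hVp : Module.Free k Vp) {s t : CentralExt Vp}
    (hcomm : s.σ * t.σ = t.σ * s.σ) {c : kˣ} (h : IsRatio Vp s.σ t.σ c) : IsCommutator s t c := by
  let u := CentralExt.mul hVp s t (s.σ * t.σ) rfl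
  let v := CentralExt.mul hVp t s (s.σ * t.σ) hcomm
  refine ⟨u, v, ⟨rfl, fun A hA => DetHom.isComp_trans _ _⟩,
    ⟨hcomm, fun A hA => DetHom.isComp_trans _ _⟩, ?_⟩
  refine CentralExt.ext rfl (heq_of_eq (funext fun A => funext fun hA => ?_))
  have hO := isObj_self hVp
  have hm := mul_mem_restrictedGL hVp s.mem t.mem
  have hLA := linked_of_isObj hVp hA
  have hLm := linked_map_of_isObj hVp hm hA
  have hV : u.Φ Vp hO = (v.Φ Vp hO).smul c := h _ _ _ _ _
  obtain ⟨α⟩ : Nonempty (DetHom Vp A) := inferInstance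
  refine DetHom.trans_left_cancel hLA hLm (α := α) ?_
  have e1 := u.trans_Φ hVp hO hA α
  have e2 := v.trans_Φ hVp hO hA α
  have e3 := DetHom.trans_smul hLA hLm α (v.Φ A hA) c
  refine Eq.trans e1 (Eq.trans ?_ e3.symm)
  refine Eq.trans (congrArg (fun φ => DetHom.trans φ (α.push (s.σ * t.σ) rfl rfl)) hV) ?_
  refine Eq.trans (DetHom.smul_trans (linked_of_mem_restrictedGL hVp hm) hLm (v.Φ Vp hO) _ c) ?_
  exact congrArg (DetHom.smul c) e2.symm

theorem IsRatio.isSymbol (hVp : Module.Free k Vp) (hcomm : σ * τ = τ * σ)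
    (hσ : σ ∈ restrictedGL Vp) (hτ : τ ∈ restrictedGL Vp) {c : kˣ} (h : IsRatio Vp σ τ c) :
    IsSymbol Vp σ τ c := by
  refine ⟨exists_lift hVp hσ, exists_lift hVp hτ, fun s t hs ht => ?_⟩
  subst hs ht
  exact h.isCommutator hVp hcomm

theorem IsRatio.eq_of_isSymbol (hVp : Module.Free k Vp) {c d : kˣ} (h : IsRatio Vp σ τ c)
    (h' : IsSymbol Vp σ τ d) : d = c := by
  obtain ⟨⟨s, rfl⟩, ⟨t, rfl⟩, hst⟩ := h'
  obtain ⟨u, v, ⟨hu, h1⟩, ⟨hv, h2⟩, rfl⟩ := hst s t rfl rfl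
  have hO := isObj_self hVp
  have hS := linked_of_mem_restrictedGL hVp s.mem
  have hS' := linked_of_mem_restrictedGL hVp t.mem
  have hL := linked_of_mem_restrictedGL hVp v.mem
  have e1 := (isComp_iff hS hL).1 (h1 Vp hO)
  have e2 := (isComp_iff hS' hL).1 (h2 Vp hO)
  have e3 := h (Vp.map (v.σ : V →ₗ[k] V))
    (by rw [show v.σ = s.σ * t.σ from hu, ← Submodule.map_comp]; rfl)
    (by rw [hv, ← Submodule.map_comp]; rfl) (s.Φ Vp hO) (t.Φ Vp hO)
  refine DetHom.smul_inj hL (α := v.Φ Vp hO) ?_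
  exact (Eq.trans e1 e3).trans (congrArg (DetHom.smul c) e2.symm)

theorem IsRatio.symbol_eq (hVp : Module.Free k Vp) (hcomm : σ * τ = τ * σ)
    (hσ : σ ∈ restrictedGL Vp) (hτ : τ ∈ restrictedGL Vp) {c : kˣ} (h : IsRatio Vp σ τ c) :
    symbol Vp σ τ = c :=
  h.eq_of_isSymbol hVp (Classical.epsilon_spec ⟨c, h.isSymbol hVp hcomm hσ hτ⟩)

theorem IsRatio.existsUnique (hVp : Module.Free k Vp) (hcomm : σ * τ = τ * σ)
    (hσ : σ ∈ restrictedGL Vp) (hτ : τ ∈ restrictedGL Vp) {c : kˣ} (h : IsRatio Vp σ τ c) :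
    ∃! c : kˣ, IsSymbol Vp σ τ c :=
  ⟨c, h.isSymbol hVp hcomm hσ hτ, fun _ hd => h.eq_of_isSymbol hVp hd⟩

end Symbol

/-! ### The pairing of complementary determinants -/

section Pairing

variable {k : Type*} [CommRing k] {V : Type*} [AddCommGroup V] [Module k V]

theorem coprod_subQuotMap_bijective {A B C P Q : Submodule k V} (hd : Disjoint A B)
    (hC : A ⊔ B = C) (hAC : A ≤ C) (hBC : B ≤ C) (hPA : P ≤ A) (hQB : Q ≤ B) :
    Function.Bijective ((subQuotMap hAC (le_sup_left : P ≤ P ⊔ Q)).coprod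
      (subQuotMap hBC (le_sup_right : Q ≤ P ⊔ Q))) := by
  refine ⟨(injective_iff_map_eq_zero _).2 ?_, fun x => ?_⟩
  · rintro ⟨x, y⟩ h
    obtain ⟨x, rfl⟩ := Submodule.Quotient.mk_surjective _ x
    obtain ⟨y, rfl⟩ := Submodule.Quotient.mk_surjective _ y
    have h' : (x : V) + y ∈ P ⊔ Q := subQuot_mk_eq_zero.1 h
    obtain ⟨p, hp, q, hq, hpq⟩ := Submodule.mem_sup.1 h'
    have hxp : (x : V) - p = q - y := by
      rw [sub_eq_sub_iff_add_eq_add, ← hpq, add_comm]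
    have h0 : (x : V) - p = 0 := Submodule.disjoint_def.1 hd _ (A.sub_mem x.2 (hPA hp))
      (hxp ▸ B.sub_mem (hQB hq) y.2)
    have hx : (Submodule.Quotient.mk x : SubQuot A P) = 0 :=
      subQuot_mk_eq_zero.2 (sub_eq_zero.1 h0 ▸ hp)
    have hy : (Submodule.Quotient.mk y : SubQuot B Q) = 0 :=
      subQuot_mk_eq_zero.2 (sub_eq_zero.1 (hxp.symm.trans h0) ▸ hq)
    rw [hx, hy]
    rfl
  · obtain ⟨⟨x, hx⟩, rfl⟩ := Submodule.Quotient.mk_surjective _ x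
    obtain ⟨a, ha, b, hb, rfl⟩ := Submodule.mem_sup.1 (hC.symm ▸ hx)
    exact ⟨(Submodule.Quotient.mk ⟨a, ha⟩, Submodule.Quotient.mk ⟨b, hb⟩), rfl⟩

theorem Admissible.sup {A B C P Q : Submodule k V} (hd : Disjoint A B) (hC : A ⊔ B = C)
    (hAP : Admissible A P) (hBQ : Admissible B Q) : Admissible C (P ⊔ Q) := by
  have := hAP.free
  have := hBQ.free
  have := hAP.free_quot
  have := hBQ.free_quot
  have := hAP.finite_quot
  have := hBQ.finite_quot
  have hb := coprod_subQuotMap_bijective hd hC (hC ▸ le_sup_left) (hC ▸ le_sup_right) hAP.le hBQ.le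
  refine ⟨hC ▸ sup_le_sup hAP.le hBQ.le, ?_, Module.Free.of_equiv (LinearEquiv.ofBijective _ hb),
    Module.Finite.equiv (LinearEquiv.ofBijective _ hb)⟩
  have hr := LinearMap.range_coprod P.subtype Q.subtype
  rw [Submodule.range_subtype, Submodule.range_subtype] at hr
  rw [← hr]
  refine Module.Free.of_equiv (LinearEquiv.ofInjective (P.subtype.coprod Q.subtype) ?_)
  rw [injective_iff_map_eq_zero]
  rintro ⟨x, y⟩ h
  have h' : (x : V) = -y := eq_neg_of_add_eq_zero_left h
  have hx : (x : V) = 0 := Submodule.disjoint_def.1 hd _ (hAP.le x.2)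
    (h' ▸ B.neg_mem (hBQ.le y.2))
  have hy : (y : V) = 0 := by rw [← neg_eq_zero, ← h', hx]
  exact Prod.ext (Subtype.ext hx) (Subtype.ext hy)

/-- The product of elements of `det (A/P)` and `det (B/Q)` in the exterior algebra
of `V / (P + Q)`. -/
def wedgeSup {A B P Q : Submodule k V} (a : DetLine k (SubQuot A P)) (b : DetLine k (SubQuot B Q)) :
    ExteriorAlgebra k (SubQuot (⊤ : Submodule k V) (P ⊔ Q)) :=
  ExteriorAlgebra.map (subQuotMap (le_top : A ≤ ⊤) (le_sup_left : P ≤ P ⊔ Q)) a *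
    ExteriorAlgebra.map (subQuotMap (le_top : B ≤ ⊤) (le_sup_right : Q ≤ P ⊔ Q)) b

theorem smul_wedgeSup_smul {A B P Q : Submodule k V} (c d : k) (a : DetLine k (SubQuot A P))
    (b : DetLine k (SubQuot B Q)) : wedgeSup (c • a) (d • b) = (c * d) • wedgeSup a b := by
  simp only [wedgeSup, Submodule.coe_smul, map_smul, smul_mul_smul_comm]

/-- The pairing of `α : det (A/P) ≃ det (A'/P)` and `β : det (B/Q) ≃ det (B'/Q)` has the value `c`.
When `V = A ⊕ B = A' ⊕ B'`, both `det (A/P) ⊗ det (B/Q)` and `det (A'/P) ⊗ det (B'/Q)` are the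
determinant of `V / (P + Q)`, and `α ⊗ β` is multiplication by `c`. -/
def Pairs {A A' B B' P Q : Submodule k V}
    (α : DetLine k (SubQuot A P) ≃ₗ[k] DetLine k (SubQuot A' P))
    (β : DetLine k (SubQuot B Q) ≃ₗ[k] DetLine k (SubQuot B' Q)) (c : k) : Prop :=
  ∀ a b, wedgeSup (α a) (β b) = c • wedgeSup a b

section

variable {A A' A'' B B' B'' P Q : Submodule k V}
  {α : DetLine k (SubQuot A P) ≃ₗ[k] DetLine k (SubQuot A' P)}
  {β : DetLine k (SubQuot B Q) ≃ₗ[k] DetLine k (SubQuot B' Q)}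

theorem Pairs.trans {α' : DetLine k (SubQuot A' P) ≃ₗ[k] DetLine k (SubQuot A'' P)}
    {β' : DetLine k (SubQuot B' Q) ≃ₗ[k] DetLine k (SubQuot B'' Q)} {c d : k}
    (h : Pairs α β c) (h' : Pairs α' β' d) : Pairs (α.trans α') (β.trans β') (d * c) := by
  intro a b
  rw [LinearEquiv.trans_apply, LinearEquiv.trans_apply, h', h, smul_smul]

theorem Pairs.smul {c x y : k} (h : Pairs α β c)
    {α' : DetLine k (SubQuot A P) ≃ₗ[k] DetLine k (SubQuot A' P)}
    {β' : DetLine k (SubQuot B Q) ≃ₗ[k] DetLine k (SubQuot B' Q)} (hα : ∀ a, α' a = x • α a)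
    (hβ : ∀ b, β' b = y • β b) : Pairs α' β' (x * y * c) := by
  intro a b
  rw [hα, hβ, smul_wedgeSup_smul, h, smul_smul]

variable [Nontrivial k]

theorem finrank_subQuot_sup (hAB : IsCompl A B) (hAP : Admissible A P) (hBQ : Admissible B Q) :
    Module.finrank k (SubQuot (⊤ : Submodule k V) (P ⊔ Q)) =
      Module.finrank k (SubQuot A P) + Module.finrank k (SubQuot B Q) := by
  have := hAP.free_quot
  have := hAP.finite_quot
  have := hBQ.free_quot
  have := hBQ.finite_quot
  exact finrank_of_coprod_bijective (coprod_subQuotMap_bijective hAB.disjoint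
    hAB.codisjoint.eq_top le_top le_top hAP.le hBQ.le)

theorem exists_isGenerator_eq_wedgeSup (hAB : IsCompl A B) (hAP : Admissible A P)
    (hBQ : Admissible B Q) {a : DetLine k (SubQuot A P)} {b : DetLine k (SubQuot B Q)}
    (ha : IsGenerator k a) (hb : IsGenerator k b) :
    ∃ z : DetLine k (SubQuot (⊤ : Submodule k V) (P ⊔ Q)), z = wedgeSup a b ∧ IsGenerator k z := by
  have := hAP.free_quot
  have := hAP.finite_quot
  have := hBQ.free_quot
  have := hBQ.finite_quot
  have hmem : wedgeSup a b ∈ ⋀[k]^(Module.finrank k (SubQuot (⊤ : Submodule k V) (P ⊔ Q)))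
      (SubQuot (⊤ : Submodule k V) (P ⊔ Q)) := by
    rw [finrank_subQuot_sup hAB hAP hBQ]
    exact map_mul_map_mem _ _ a.2 b.2
  exact ⟨⟨_, hmem⟩, rfl, IsGenerator.mul (coprod_subQuotMap_bijective hAB.disjoint
    hAB.codisjoint.eq_top le_top le_top hAP.le hBQ.le) ha hb rfl⟩

theorem wedgeSup_smul_inj (hAB : IsCompl A B) (hAP : Admissible A P)
    (hBQ : Admissible B Q) {a : DetLine k (SubQuot A P)} {b : DetLine k (SubQuot B Q)}
    (ha : IsGenerator k a) (hb : IsGenerator k b) {c d : k}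
    (h : c • wedgeSup a b = d • wedgeSup a b) : c = d := by
  obtain ⟨z, hz, hz'⟩ := exists_isGenerator_eq_wedgeSup hAB hAP hBQ ha hb
  refine hz'.smul_inj (Subtype.ext ?_)
  rw [Submodule.coe_smul, Submodule.coe_smul, hz, h]

theorem Pairs.eq (hAB : IsCompl A B) (hAP : Admissible A P) (hBQ : Admissible B Q) {c d : k}
    (h : Pairs α β c) (h' : Pairs α β d) : c = d := by
  obtain ⟨a, ha⟩ := hAP.exists_isGenerator
  obtain ⟨b, hb⟩ := hBQ.exists_isGenerator
  exact wedgeSup_smul_inj hAB hAP hBQ ha hb ((h a b).symm.trans (h' a b))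

theorem exists_pairs (hAB : IsCompl A B) (hAB' : IsCompl A' B') (hAP : Admissible A P)
    (hBQ : Admissible B Q) (hAP' : Admissible A' P) (hBQ' : Admissible B' Q)
    (α : DetLine k (SubQuot A P) ≃ₗ[k] DetLine k (SubQuot A' P))
    (β : DetLine k (SubQuot B Q) ≃ₗ[k] DetLine k (SubQuot B' Q)) :
    ∃ c : kˣ, Pairs α β (c : k) := by
  obtain ⟨a, ha⟩ := hAP.exists_isGenerator
  obtain ⟨b, hb⟩ := hBQ.exists_isGenerator
  obtain ⟨z, hz, hz'⟩ := exists_isGenerator_eq_wedgeSup hAB hAP hBQ ha hb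
  obtain ⟨w, hw, hw'⟩ := exists_isGenerator_eq_wedgeSup hAB' hAP' hBQ' (ha.map α) (hb.map β)
  obtain ⟨c, hc⟩ := hz'.exists_unit_smul hw'
  refine ⟨c, fun x y => ?_⟩
  obtain ⟨s, rfl⟩ := ha.exists_smul x
  obtain ⟨t, rfl⟩ := hb.exists_smul y
  rw [map_smul, map_smul, smul_wedgeSup_smul, smul_wedgeSup_smul, ← hw, ← hz, ← hc, smul_comm]
  rfl

end

/-- The pairing is invariant under automorphisms of `V`. -/
theorem Pairs.map (σ : V ≃ₗ[k] V) {A A' B B' A₁ A₁' B₁ B₁' P Q : Submodule k V}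
    (hA : A.map (σ : V →ₗ[k] V) = A₁) (hA' : A'.map (σ : V →ₗ[k] V) = A₁')
    (hB : B.map (σ : V →ₗ[k] V) = B₁) (hB' : B'.map (σ : V →ₗ[k] V) = B₁')
    {α : DetLine k (SubQuot A (P.comap (σ : V →ₗ[k] V))) ≃ₗ[k]
      DetLine k (SubQuot A' (P.comap (σ : V →ₗ[k] V)))}
    {β : DetLine k (SubQuot B (Q.comap (σ : V →ₗ[k] V))) ≃ₗ[k]
      DetLine k (SubQuot B' (Q.comap (σ : V →ₗ[k] V)))} {c : k} (h : Pairs α β c) :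
    Pairs ((detEquiv (subQuotEquiv σ hA P)).symm.trans (α.trans (detEquiv (subQuotEquiv σ hA' P))))
      ((detEquiv (subQuotEquiv σ hB Q)).symm.trans (β.trans (detEquiv (subQuotEquiv σ hB' Q)))) c := by
  have htop : (⊤ : Submodule k V).map (σ : V →ₗ[k] V) = ⊤ := by
    rw [Submodule.map_top]
    exact LinearEquiv.range σ
  let S := (subQuotEquiv σ htop (P ⊔ Q)).toLinearMap ∘ₗ subQuotMap (le_refl ⊤)
    (sup_le (Submodule.comap_mono le_sup_left) (Submodule.comap_mono le_sup_right) :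
      P.comap (σ : V →ₗ[k] V) ⊔ Q.comap (σ : V →ₗ[k] V) ≤ (P ⊔ Q).comap (σ : V →ₗ[k] V))
  have hS : ∀ {C D C₁ D₁ : Submodule k V} (hC : C.map (σ : V →ₗ[k] V) = C₁)
      (hD : D.map (σ : V →ₗ[k] V) = D₁)
      (x : DetLine k (SubQuot C (P.comap (σ : V →ₗ[k] V))))
      (y : DetLine k (SubQuot D (Q.comap (σ : V →ₗ[k] V)))),
      ExteriorAlgebra.map S (wedgeSup x y) =
        wedgeSup (detEquiv (subQuotEquiv σ hC P) x) (detEquiv (subQuotEquiv σ hD Q) y) := by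
    intro C D C₁ D₁ hC hD x y
    refine (map_mul _ _ _).trans (congrArg₂ (· * ·) ?_ ?_)
    · refine (map_map _ _ _).trans (Eq.trans ?_ (map_map _ _ _).symm)
      refine congrArg (fun f => ExteriorAlgebra.map f x.1) (LinearMap.ext fun z => ?_)
      obtain ⟨z, rfl⟩ := Submodule.Quotient.mk_surjective _ z
      rfl
    · refine (map_map _ _ _).trans (Eq.trans ?_ (map_map _ _ _).symm)
      refine congrArg (fun f => ExteriorAlgebra.map f y.1) (LinearMap.ext fun z => ?_)
      obtain ⟨z, rfl⟩ := Submodule.Quotient.mk_surjective _ z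
      rfl
  intro a b
  obtain ⟨a, rfl⟩ := (detEquiv (subQuotEquiv σ hA P)).surjective a
  obtain ⟨b, rfl⟩ := (detEquiv (subQuotEquiv σ hB Q)).surjective b
  simp only [LinearEquiv.trans_apply, LinearEquiv.symm_apply_apply]
  rw [← hS, ← hS, h, map_smul]

/-- Enlarging `A/P` and `B/Q` changes the value of the pairing by the sign of moving a generator of
`det (Q/Q')` past `det (A/P)` on one side and past `det (A'/P)` on the other. -/
theorem Pairs.cancels [Nontrivial k] {A A' B B' P P' Q Q' : Submodule k V} (hAB : IsCompl A B)
    (hAP : Admissible A P) (hAP' : Admissible A' P) (hBQ : Admissible B Q)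
    (hBQ' : Admissible B' Q) (hP : Admissible P P') (hQ : Admissible Q Q')
    {α : DetLine k (SubQuot A P) ≃ₗ[k] DetLine k (SubQuot A' P)}
    {α' : DetLine k (SubQuot A P') ≃ₗ[k] DetLine k (SubQuot A' P')}
    {β : DetLine k (SubQuot B Q) ≃ₗ[k] DetLine k (SubQuot B' Q)}
    {β' : DetLine k (SubQuot B Q') ≃ₗ[k] DetLine k (SubQuot B' Q')}
    (hα : Cancels hP.le hAP.le hAP'.le α' α) (hβ : Cancels hQ.le hBQ.le hBQ'.le β' β)
    {c c' : k} (h : Pairs α β c) (h' : Pairs α' β' c') :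
    (-1) ^ (Module.finrank k (SubQuot A P) * Module.finrank k (SubQuot Q Q')) * c' =
      (-1) ^ (Module.finrank k (SubQuot A' P) * Module.finrank k (SubQuot Q Q')) * c := by
  obtain ⟨p, hp⟩ := hP.exists_isGenerator
  obtain ⟨q, hq⟩ := hQ.exists_isGenerator
  obtain ⟨a, ta, pa, ha⟩ := exists_isFrame hAP hP hp
  obtain ⟨a₁, ta₁, pa₁, ha₁⟩ := exists_isFrame hAP' hP hp
  obtain ⟨b, tb, qb, hb⟩ := exists_isFrame hBQ hQ hq
  obtain ⟨b₁, tb₁, qb₁, hb₁⟩ := exists_isFrame hBQ' hQ hq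
  obtain ⟨u, hu⟩ := ha₁.gen_right.exists_smul (α ta)
  obtain ⟨u', hu'⟩ := (ha₁.gen_wedge hAP' hP).exists_smul (α' pa)
  obtain rfl : u = u' := (cancels_iff hAP hAP' hP ha ha₁ hu.symm hu'.symm).1 hα
  obtain ⟨v, hv⟩ := hb₁.gen_right.exists_smul (β tb)
  obtain ⟨v', hv'⟩ := (hb₁.gen_wedge hBQ' hQ).exists_smul (β' qb)
  obtain rfl : v = v' := (cancels_iff hBQ hBQ' hQ hb hb₁ hv.symm hv'.symm).1 hβ
  have hPQ : Disjoint P Q := hAB.disjoint.mono hAP.le hBQ.le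
  have hK : Admissible (P ⊔ Q) (P' ⊔ Q') := Admissible.sup hPQ rfl hP hQ
  have hM : Admissible ⊤ (P ⊔ Q) := Admissible.sup hAB.disjoint hAB.codisjoint.eq_top hAP hBQ
  -- `κ = p ∧ q` lies in the determinant of `(P + Q) / (P' + Q')`.
  let κ : DetLine k (SubQuot (P ⊔ Q) (P' ⊔ Q')) :=
    ⟨ExteriorAlgebra.map (subQuotMap le_sup_left (le_sup_left : P' ≤ P' ⊔ Q')) p *
      ExteriorAlgebra.map (subQuotMap le_sup_right (le_sup_right : Q' ≤ P' ⊔ Q')) q, by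
        have := hP.free_quot
        have := hP.finite_quot
        have := hQ.free_quot
        have := hQ.finite_quot
        rw [finrank_of_coprod_bijective (coprod_subQuotMap_bijective hPQ rfl le_sup_left
          le_sup_right hP.le hQ.le)]
        exact map_mul_map_mem _ _ p.2 q.2⟩
  -- The forms `p`, `q` and the liftings `x`, `y` are multiplied in the exterior algebra of
  -- `V / (P' + Q')`; moving `q` to the left past `x` produces the sign.
  let f {C : Submodule k V} : SubQuot C P' →ₗ[k] SubQuot ⊤ (P' ⊔ Q') :=
    subQuotMap le_top le_sup_left
  let g {C : Submodule k V} : SubQuot C Q' →ₗ[k] SubQuot ⊤ (P' ⊔ Q') :=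
    subQuotMap le_top le_sup_right
  set xp := ExteriorAlgebra.map (subQuotMap (le_top : P ≤ ⊤) (le_sup_left : P' ≤ P' ⊔ Q')) p
    with hxp
  set xq := ExteriorAlgebra.map (subQuotMap (le_top : Q ≤ ⊤) (le_sup_right : Q' ≤ P' ⊔ Q')) q
    with hxq
  have hκ : ExteriorAlgebra.map (subQuotMap le_top (le_refl (P' ⊔ Q'))) κ.1 = xp * xq := by
    rw [map_mul, map_subQuotMap_map, map_subQuotMap_map]
  have hwedge : ∀ {C D : Submodule k V} (hC : Admissible C P) (hD : Admissible D Q)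
      {x tx px y ty qy} (hx : IsFrame hP.le hC.le p x tx px) (hy : IsFrame hQ.le hD.le q y ty qy),
      wedgeSup px qy =
        ((-1) ^ (Module.finrank k (SubQuot C P) * Module.finrank k (SubQuot Q Q')) : k) •
        (xp * xq * (ExteriorAlgebra.map f (x : ExteriorAlgebra k (SubQuot C P')) *
          ExteriorAlgebra.map g (y : ExteriorAlgebra k (SubQuot D Q')))) := by
    intro C D hC hD x tx px y ty qy hx hy
    have h1 : ExteriorAlgebra.map f (x : ExteriorAlgebra k (SubQuot C P')) * xq =
        (-1) ^ (Module.finrank k (SubQuot C P) * Module.finrank k (SubQuot Q Q')) *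
          (xq * ExteriorAlgebra.map f (x : ExteriorAlgebra k (SubQuot C P'))) :=
      mul_eq_neg_one_pow_mul (map_mem_exteriorPower _ x.2) (map_mem_exteriorPower _ q.2)
    have h2 : wedgeSup px qy = xp * ExteriorAlgebra.map f (x : ExteriorAlgebra k (SubQuot C P')) *
        (xq * ExteriorAlgebra.map g (y : ExteriorAlgebra k (SubQuot D Q'))) := by
      rw [wedgeSup, hx.wedge_eq, hy.wedge_eq, map_mul, map_mul, map_subQuotMap_map,
        map_subQuotMap_map]
    have h3 := ((Commute.neg_one_left xp).pow_left
      (Module.finrank k (SubQuot C P) * Module.finrank k (SubQuot Q Q'))).eq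
    rw [h2, mul_assoc, ← mul_assoc _ xq, h1, mul_assoc, ← mul_assoc xp, ← h3, Algebra.smul_def,
      map_pow, map_neg, map_one]
    simp only [mul_assoc]
  have hred : ∀ {C D : Submodule k V} (hC : Admissible C P) (hD : Admissible D Q)
      {x tx px y ty qy} (hx : IsFrame hP.le hC.le p x tx px) (hy : IsFrame hQ.le hD.le q y ty qy),
      ExteriorAlgebra.map (subQuotMap (le_refl ⊤) hK.le)
        (ExteriorAlgebra.map f (x : ExteriorAlgebra k (SubQuot C P')) *
          ExteriorAlgebra.map g (y : ExteriorAlgebra k (SubQuot D Q'))) = wedgeSup tx ty := by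
    intro C D hC hD x tx px y ty qy hx hy
    rw [map_mul, map_subQuotMap_map, map_subQuotMap_map, wedgeSup, hx.map_eq, hy.map_eq,
      map_subQuotMap_map, map_subQuotMap_map]
  set W := ExteriorAlgebra.map f (a : ExteriorAlgebra k (SubQuot A P')) *
    ExteriorAlgebra.map g (b : ExteriorAlgebra k (SubQuot B Q')) with hW
  set W₁ := ExteriorAlgebra.map f (a₁ : ExteriorAlgebra k (SubQuot A' P')) *
    ExteriorAlgebra.map g (b₁ : ExteriorAlgebra k (SubQuot B' Q')) with hW₁
  -- Multiplied by `κ`, the products `a₁ ∧ b₁` and `a ∧ b` are compared modulo `P + Q`.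
  have hmain : xp * xq * ((u * v) • W₁) = xp * xq * (c • W) := by
    rw [← hκ]
    refine wedge_eq_wedge hM hK κ ?_
    rw [map_smul, map_smul, hred hAP hBQ ha hb, hred hAP' hBQ' ha₁ hb₁, ← h, ← hu, ← hv,
      smul_wedgeSup_smul]
  rw [mul_smul_comm, mul_smul_comm] at hmain
  have hleft := h' pa qb
  rw [← hu', ← hv', smul_wedgeSup_smul, hwedge hAP' hBQ' ha₁ hb₁, smul_comm, hmain] at hleft
  have hZ := hwedge hAP hBQ ha hb
  refine wedgeSup_smul_inj hAB (hAP.trans hP) (hBQ.trans hQ) (ha.gen_wedge hAP hP)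
    (hb.gen_wedge hBQ hQ) ?_
  rw [mul_smul, ← hleft, hZ, smul_comm, mul_smul, smul_comm _ c]

end Pairing

/-! ### Complementary submodules have inverse symbols -/

section Reciprocity

variable {k : Type*} [CommRing k] [IsLocalRing k] [IsArtinianRing k]
  {V : Type*} [AddCommGroup V] [Module k V]

omit [IsLocalRing k] [IsArtinianRing k] in
theorem isCompl_map (σ : V ≃ₗ[k] V) {A B : Submodule k V} (h : IsCompl A B) :
    IsCompl (A.map (σ : V →ₗ[k] V)) (B.map (σ : V →ₗ[k] V)) :=
  (Submodule.orderIsoMapComap σ).isCompl h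

omit [IsLocalRing k] [IsArtinianRing k] in
theorem eq_neg_one_pow_mul_of_mul_eq {i j : ℕ} {x y : k} (h : (-1) ^ i * x = (-1) ^ j * y) :
    x = (-1) ^ (i + j) * y := by
  rw [pow_add, mul_assoc, ← h, ← mul_assoc, ← pow_add, Even.neg_one_pow ⟨i, rfl⟩, one_mul]

omit [IsLocalRing k] [IsArtinianRing k] in
theorem neg_one_pow_eq_of_add_two_mul {m n s t : ℕ} (h : m + 2 * s = n + 2 * t) :
    (-1 : k) ^ m = (-1) ^ n := by
  have h' := congrArg (fun i => (-1 : k) ^ i) h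
  simpa [pow_add, pow_mul] using h'

omit [IsLocalRing k] [IsArtinianRing k] in
/-- The sign accumulated when a level is lowered from `(P, Q)` and raised again to another one, in
terms of ranks. -/
theorem neg_one_pow_level {a a' b b' p p' r r' m n : ℕ} (h₁ : p + a = p' + b)
    (h₂ : p + a' = p' + b') (h₃ : r + m = r' + n) :
    (-1 : k) ^ (b' * r' + b * r' + (a * r + a' * r)) = (-1) ^ ((a + a') * (m + n)) := by
  refine neg_one_pow_eq_of_add_two_mul (s := p' * r' + n * (a + a'))
    (t := p * r' + r * (a + a')) ?_
  zify at h₁ h₂ h₃ ⊢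
  linear_combination (-(r' : ℤ)) * h₁ - (r' : ℤ) * h₂ - ((a : ℤ) + a') * h₃

omit [IsLocalRing k] [IsArtinianRing k] in
/-- Both exponents are, up to parity, the product of the indices `p + p₁` and `p + p₂`. -/
theorem neg_one_pow_index {p p₁ p₂ m m₁ m₂ : ℕ} (h₁ : p + m = p₁ + m₁) (h₂ : p + m = p₂ + m₂) :
    (-1 : k) ^ ((p + p₁) * (m + m₂)) = (-1) ^ ((p + p₂) * (m + m₁)) := by
  refine neg_one_pow_eq_of_add_two_mul (s := p₂ * (m + p)) (t := p₁ * (m + p)) ?_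
  zify at h₁ h₂ ⊢
  linear_combination (-((p : ℤ) + p₁)) * h₂ + ((p : ℤ) + p₂) * h₁

/-- Passing from `α`, `β` to `σ_* α`, `σ_* β` changes the value of the pairing at a fixed level by
the sign of the product of the index of `σ` and the index of `α`, because `σ_*` moves the level. -/
theorem pairs_push {A A' B B' A₁ A₁' B₁ B₁' P Q : Submodule k V} (σ : V ≃ₗ[k] V)
    (hA : A.map (σ : V →ₗ[k] V) = A₁) (hA' : A'.map (σ : V →ₗ[k] V) = A₁')
    (hB : B.map (σ : V →ₗ[k] V) = B₁) (hB' : B'.map (σ : V →ₗ[k] V) = B₁')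
    (hAB : IsCompl A B) (hAB' : IsCompl A' B')
    (hAP : Admissible A P) (hAP' : Admissible A' P) (hAP₁ : Admissible A₁ P)
    (hAP₁' : Admissible A₁' P) (hBQ : Admissible B Q) (hBQ' : Admissible B' Q)
    (hBQ₁ : Admissible B₁ Q) (hBQ₁' : Admissible B₁' Q) (α : DetHom A A') (β : DetHom B B')
    {x y : k} (hx : Pairs (α.app P hAP hAP') (β.app Q hBQ hBQ') x)
    (hy : Pairs ((α.push σ hA hA').app P hAP₁ hAP₁') ((β.push σ hB hB').app Q hBQ₁ hBQ₁') y) :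
    y = (-1) ^ ((Module.finrank k (SubQuot A P) + Module.finrank k (SubQuot A' P)) *
      (Module.finrank k (SubQuot B Q) + Module.finrank k (SubQuot B₁ Q))) * x := by
  have hAσ := hAP₁.comap σ hA
  have hAσ' := hAP₁'.comap σ hA'
  have hBσ := hBQ₁.comap σ hB
  have hBσ' := hBQ₁'.comap σ hB'
  obtain ⟨z, hz⟩ := exists_pairs hAB hAB' hAσ hBσ hAσ' hBσ' (α.app _ hAσ hAσ') (β.app _ hBσ hBσ')
  have hAB₁ : IsCompl A₁ B₁ := hA ▸ hB ▸ isCompl_map σ hAB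
  obtain rfl : z = y := (hz.map σ hA hA' hB hB').eq hAB₁ hAP₁ hBQ₁ hy
  -- A level `(R, S)` below both `(P, Q)` and `(σ⁻¹ P, σ⁻¹ Q)` compares the two.
  obtain ⟨R, hRP, hRσ, hR⟩ := hAP.exists_le_inf hAσ
  obtain ⟨S, hSQ, hSσ, hS⟩ := hBQ.exists_le_inf hBσ
  have hPR := hAP.restrict hR hRP
  have hσR := hAσ.restrict hR hRσ
  have hQS := hBQ.restrict hS hSQ
  have hσS := hBσ.restrict hS hSσ
  have hR' := hAP'.trans hPR
  have hS' := hBQ'.trans hQS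
  obtain ⟨w, hw⟩ := exists_pairs hAB hAB' hR hS hR' hS' (α.app R hR hR') (β.app S hS hS')
  have e1 := hx.cancels hAB hAP hAP' hBQ hBQ' hPR hQS (α.cancels _ _ hAP hAP' hR hR' hRP)
    (β.cancels _ _ hBQ hBQ' hS hS' hSQ) hw
  have e2 := hz.cancels hAB hAσ hAσ' hBσ hBσ' hσR hσS (α.cancels _ _ hAσ hAσ' hR hR' hRσ)
    (β.cancels _ _ hBσ hBσ' hS hS' hSσ) hw
  have f1 := hAP.finrank_add hPR
  have f2 := hAP'.finrank_add hPR
  have f3 := hAσ.finrank_add hσR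
  have f4 := hAσ'.finrank_add hσR
  have f5 := hBQ.finrank_add hQS
  have f6 := hBσ.finrank_add hσS
  have f7 := (subQuotEquiv σ hB Q).finrank_eq
  rw [eq_neg_one_pow_mul_of_mul_eq e2.symm, eq_neg_one_pow_mul_of_mul_eq e1, ← mul_assoc, ← pow_add]
  rw [f7] at f6
  rw [neg_one_pow_level (f1.symm.trans f3) (f2.symm.trans f4) (f5.symm.trans f6)]

/-- The symbols at the two summands of `V = V₊ ⊕ V₋` are inverse to each other. -/
theorem IsRatio.mul_eq_one {Vp Vm : Submodule k V} (hVp : Module.Free k Vp)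
    (hVm : Module.Free k Vm) (hV : IsCompl Vp Vm) {σ τ : V ≃ₗ[k] V} (hcomm : σ * τ = τ * σ)
    (hσp : σ ∈ restrictedGL Vp) (hσm : σ ∈ restrictedGL Vm)
    (hτp : τ ∈ restrictedGL Vp) (hτm : τ ∈ restrictedGL Vm) {c d : kˣ}
    (hc : IsRatio Vp σ τ c) (hd : IsRatio Vm σ τ d) : c * d = 1 := by
  have hT : ∀ A : Submodule k V, (A.map (σ : V →ₗ[k] V)).map (τ : V →ₗ[k] V) =
      (A.map (τ : V →ₗ[k] V)).map (σ : V →ₗ[k] V) := fun A => by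
    rw [← Submodule.map_comp, ← Submodule.map_comp]
    exact congrArg (fun f : V ≃ₗ[k] V => A.map (f : V →ₗ[k] V)) hcomm.symm
  have lp := linked_of_mem_restrictedGL hVp hσp
  have lp' := linked_of_mem_restrictedGL hVp hτp
  have lm := linked_of_mem_restrictedGL hVm hσm
  have lm' := linked_of_mem_restrictedGL hVm hτm
  obtain ⟨P, hP, hPσ, hPτ, hPT⟩ := lp.exists_admissible₄ lp' (lp.trans (lp'.map σ))
  obtain ⟨Q, hQ, hQσ, hQτ, hQT⟩ := lm.exists_admissible₄ lm' (lm.trans (lm'.map σ))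
  obtain ⟨α⟩ : Nonempty (DetHom Vp (Vp.map (σ : V →ₗ[k] V))) := inferInstance
  obtain ⟨β⟩ : Nonempty (DetHom Vp (Vp.map (τ : V →ₗ[k] V))) := inferInstance
  obtain ⟨α'⟩ : Nonempty (DetHom Vm (Vm.map (σ : V →ₗ[k] V))) := inferInstance
  obtain ⟨β'⟩ : Nonempty (DetHom Vm (Vm.map (τ : V →ₗ[k] V))) := inferInstance
  have hVσ := isCompl_map σ hV
  have hVτ := isCompl_map τ hV
  have hVT := isCompl_map σ hVτ
  obtain ⟨x, hx⟩ := exists_pairs hV hVσ hP hQ hPσ hQσ (α.app P hP hPσ) (α'.app Q hQ hQσ)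
  obtain ⟨y, hy⟩ := exists_pairs hV hVτ hP hQ hPτ hQτ (β.app P hP hPτ) (β'.app Q hQ hQτ)
  obtain ⟨x₁, hx₁⟩ := exists_pairs hVτ hVT hPτ hQτ hPT hQT
    ((α.push τ rfl (hT Vp)).app P hPτ hPT) ((α'.push τ rfl (hT Vm)).app Q hQτ hQT)
  obtain ⟨y₁, hy₁⟩ := exists_pairs hVσ hVT hPσ hQσ hPT hQT
    ((β.push σ rfl rfl).app P hPσ hPT) ((β'.push σ rfl rfl).app Q hQσ hQT)
  have ex := pairs_push τ rfl (hT Vp) rfl (hT Vm) hV hVσ hP hPσ hPτ hPT hQ hQσ hQτ hQT α α' hx hx₁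
  have ey := pairs_push σ rfl rfl rfl rfl hV hVτ hP hPτ hPσ hPT hQ hQτ hQσ hQT β β' hy hy₁
  have hp := congrArg (fun γ => DetHom.app γ P hP hPT) (hc _ rfl (hT Vp) α β)
  have hm := congrArg (fun γ => DetHom.app γ Q hQ hQT) (hd _ rfl (hT Vm) α' β')
  simp only [DetHom.trans_app _ _ hP hPσ hPT, DetHom.trans_app _ _ hQ hQσ hQT] at hp hm
  have h1 := hx.trans hy₁
  have h2 := (hy.trans hx₁).smul (x := (c : k)) (y := (d : k))
    (fun a => (LinearEquiv.congr_fun hp a).trans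
      (congrArg (c • ·) (LinearEquiv.congr_fun (DetHom.trans_app _ _ hP hPτ hPT) a)))
    (fun a => (LinearEquiv.congr_fun hm a).trans
      (congrArg (d • ·) (LinearEquiv.congr_fun (DetHom.trans_app _ _ hQ hQτ hQT) a)))
  -- Both sides are values of the pairing on `σ_* β ∘ α`, `σ_* β' ∘ α'`.
  have h3 := h1.eq hV hP hQ h2
  have r0 := finrank_subQuot_sup hV hP hQ
  have r1 := finrank_subQuot_sup hVσ hPσ hQσ
  have r2 := finrank_subQuot_sup hVτ hPτ hQτ
  rw [neg_one_pow_index (r0.symm.trans r1) (r0.symm.trans r2)] at ex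
  set e := ((-1 : k)) ^ ((Module.finrank k (SubQuot Vp P) +
    Module.finrank k (SubQuot (Vp.map (τ : V →ₗ[k] V)) P)) * (Module.finrank k (SubQuot Vm Q) +
    Module.finrank k (SubQuot (Vm.map (σ : V →ₗ[k] V)) Q))) with he
  have hu : IsUnit (e * x * y) :=
    ((isUnit_one.neg.pow _).mul x.isUnit).mul y.isUnit
  refine Units.ext (hu.mul_right_cancel ?_)
  rw [ex, ey] at h3
  rw [Units.val_mul, Units.val_one]
  linear_combination -h3

end Reciprocity

end DetGroupoid

end

theorem mainTheorem3 {k : Type*} [CommRing k] [IsLocalRing k] [IsArtinianRing k]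
    {V : Type*} [AddCommGroup V] [Module k V] (hV : Module.Free k V)
    (Vp Vm : Submodule k V) (hVp : Module.Free k Vp) (hVm : Module.Free k Vm)
    (hsum : IsCompl Vp Vm) (σ τ : V ≃ₗ[k] V) (hcomm : σ * τ = τ * σ)
    (hσp : σ ∈ DetGroupoid.restrictedGL Vp) (hσm : σ ∈ DetGroupoid.restrictedGL Vm)
    (hτp : τ ∈ DetGroupoid.restrictedGL Vp) (hτm : τ ∈ DetGroupoid.restrictedGL Vm) :
    (∃! c : kˣ, DetGroupoid.IsSymbol Vp σ τ c) ∧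
      (∃! c : kˣ, DetGroupoid.IsSymbol Vm σ τ c) ∧
      DetGroupoid.symbol Vp σ τ * DetGroupoid.symbol Vm σ τ = 1 := by
  obtain ⟨c, hc⟩ := DetGroupoid.exists_isRatio hVp hσp hτp
  obtain ⟨d, hd⟩ := DetGroupoid.exists_isRatio hVm hσm hτm
  refine ⟨hc.existsUnique hVp hcomm hσp hτp, hd.existsUnique hVm hcomm hσm hτm, ?_⟩
  rw [hc.symbol_eq hVp hcomm hσp hτp, hd.symbol_eq hVm hcomm hσm hτm]
  exact hc.mul_eq_one hVp hVm hsum hcomm hσp hσm hτp hτm hd
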